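/- Let $d\ge1$, $\alpha\in\mathbb R\setminus\{0\}$ and $(\beta,\gamma)\in\mathbb R^2\setminus\{(0,0)\}$. Let $\mathcal F$ be the Fourier transform on $\mathcal S'(\mathbb R^d)$, extending $(\mathcal Fg)(\xi)=\int_{\mathbb R^d}g(x)e^{-ix\cdot\xi}\,dx$, and for $t\in\mathbb R$ let $$W(t)=\mathcal F^{-1}e^{i(\alpha|\xi|^2+\beta\xi_1^3+\gamma\xi_1^4)t}\mathcal F$$ on $\mathcal S'(\mathbb R^d)$. Let $\sigma_0\in C^\infty(\mathbb R^d)$ be complex-valued with $\operatorname{supp}\sigma_0\subseteq\{|\xi|<\sqrt d\}$, with $|\sigma_0|\ge c$ on $[-\tfrac12,\tfrac12]^d$ for some $c>0$, and with $\sum_{k\in\mathbb Z^d}\sigma_0(\xi-k)=1$ for all $\xi\in\mathbb R^d$. Put $\Box_k=\mathcal F^{-1}\sigma_0(\cdot-k)\mathcal F$ and, for $s\in\mathbb R$, $p,q\in[1,\infty]$ and $f\in\mathcal S'(\mathbb R^d)$, $$\|f\|_{M^s_{p,q}}=\Big\|\big\{(1+|k|)^s\|\Box_kf\|_{L^p(\mathbb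 R^d)}\big\}_{k\in\mathbb Z^d}\Big\|_{\ell^q(\mathbb Z^d)}\in[0,\infty],$$ where $\|u\|_{L^p}=\infty$ if the tempered distribution $u$ is not given by an $L^p$ function. Theorem 1.4. For all $s\in\mathbb R$, $p\in[2,\infty]$ and $q\in[1,\infty]$, with $\tfrac1p+\tfrac1{p'}=1$, there is a constant $C>0$, independent of $t$ and $f$, such that for all $t\in\mathbb R$ and all $f\in\mathcal S'(\mathbb R^d)$ $$\|W(t)f\|_{M^s_{p,q}}\le C\,(1+|t|)^{-\mu}\,\|f\|_{M^s_{p',q}},\qquad \mu=\begin{cases}(d-\tfrac12)(\tfrac12-\tfrac1p),&\gamma\ne0,\\(d-\tfrac13)(\tfrac12-\tfrac1p),&\gamma=0.\end{cases}$$ In particular, $W(t)$ maps $M^s_{p',q}=\{f\in\mathcal S'(\mathbb R^d):\|f\|_{M^s_{p',q}}<\infty\}$ into $M^s_{p,q}$. -/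

import Mathlib

open MeasureTheory Real
open scoped ENNReal SchwartzMap ContDiff

noncomputable section

/-- The Fourier multiplier operator `𝓕⁻¹ m 𝓕` on tempered distributions on `ℝ^d`, where
`(𝓕 f)(ξ) = ∫ f(x) e^{-i x·ξ} dx`, so that `i ξ_j` is the symbol of `∂_j`. Mathlib's Fourier
transform uses `e^{-2 π i x·ξ}`, so the symbol is evaluated at `2 π ξ`. -/
def angularMultiplier {d : ℕ} (m : EuclideanSpace ℝ (Fin d) → ℂ) :
    𝓢'(EuclideanSpace ℝ (Fin d), ℂ) →L[ℂ] 𝓢'(EuclideanSpace ℝ (Fin d), ℂ) :=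
  TemperedDistribution.fourierMultiplierCLM ℂ (fun ξ => m ((2 * π) • ξ))

/-- An integer vector as a point of Euclidean space. -/
def latticePoint {d : ℕ} (k : Fin d → ℤ) : EuclideanSpace ℝ (Fin d) :=
  WithLp.toLp 2 (fun i => (k i : ℝ))

/-- `σ₀` is an admissible window: it is smooth, its integer translates `σ₀(· - k)` form a
partition of unity, it is bounded away from zero on the unit cube centred at the origin, and its
support lies in the open ball of radius `√d` about the origin. -/
structure IsModulationWindow {d : ℕ} (σ₀ : EuclideanSpace ℝ (Fin d) → ℂ) : Prop where
  smooth : ContDiff ℝ ∞ σ₀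
  hasSum_one : ∀ ξ, HasSum (fun k : Fin d → ℤ => σ₀ (ξ - latticePoint k)) 1
  lower_bound : ∃ c : ℝ, 0 < c ∧
    ∀ η : EuclideanSpace ℝ (Fin d), (∀ i, |η i| ≤ 1 / 2) → c ≤ ‖σ₀ η‖
  tsupport_subset : tsupport σ₀ ⊆ Metric.ball 0 (√(d : ℝ))

/-- The isometric decomposition operator `□_k = 𝓕⁻¹ σ₀(· - k) 𝓕`. -/
def boxOp {d : ℕ} (σ₀ : EuclideanSpace ℝ (Fin d) → ℂ) (k : Fin d → ℤ) :
    𝓢'(EuclideanSpace ℝ (Fin d), ℂ) →L[ℂ] 𝓢'(EuclideanSpace ℝ (Fin d), ℂ) :=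
  angularMultiplier (fun ξ => σ₀ (ξ - latticePoint k))

/-- The `L^p` norm (`1 ≤ p ≤ ∞`) of a tempered distribution: the norm of the `L^p` function that
represents it (unique almost everywhere), and `∞` if there is no such function. -/
def distLpNorm {d : ℕ} (p : ℝ≥0∞) (u : 𝓢'(EuclideanSpace ℝ (Fin d), ℂ)) : ℝ≥0∞ :=
  ⨅ (g : EuclideanSpace ℝ (Fin d) → ℂ) (_ : MemLp g p volume)
    (_ : ∀ φ : 𝓢(EuclideanSpace ℝ (Fin d), ℂ), u φ = ∫ x, φ x * g x), eLpNorm g p volume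

/-- The modulation space norm `‖ (⟨k⟩^s ‖□_k f‖_p)_k ‖_{ℓ^q(ℤ^d)}` with `⟨k⟩ = 1 + |k|`, with
values in `[0, ∞]`; the space `M^s_{p,q}` consists of the `f` for which it is finite. -/
def modulationNorm {d : ℕ} (σ₀ : EuclideanSpace ℝ (Fin d) → ℂ) (s : ℝ) (p q : ℝ≥0∞)
    (f : 𝓢'(EuclideanSpace ℝ (Fin d), ℂ)) : ℝ≥0∞ :=
  eLpNorm (fun k : Fin d → ℤ =>
    ENNReal.ofReal ((1 + ‖latticePoint k‖) ^ s) * distLpNorm p (boxOp σ₀ k f)) q Measure.count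

/-- The symbol `e^{i (α |ξ|² + β ξ₁³ + γ ξ₁⁴) t}`; the coordinate `ξ₁` is `ξ 0`. -/
def propagatorSymbol {d : ℕ} [NeZero d] (α β γ t : ℝ) (ξ : EuclideanSpace ℝ (Fin d)) : ℂ :=
  Complex.exp (Complex.I * (((α * ‖ξ‖ ^ 2 + β * ξ 0 ^ 3 + γ * ξ 0 ^ 4) * t : ℝ) : ℂ))

lemma hasTemperateGrowth_cexp_I_mul : Function.HasTemperateGrowth (fun x : ℝ => Complex.exp (Complex.I * (x : ℂ))) := by
  have key : ∀ n : ℕ, iteratedDeriv n (fun x : ℝ => Complex.exp (Complex.I * (x : ℂ))) =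
      fun x : ℝ => Complex.I ^ n * Complex.exp (Complex.I * (x : ℂ)) := by
    intro n
    induction n with
    | zero => simp
    | succ n ih =>
      rw [iteratedDeriv_succ, ih]
      funext x
      have h : HasDerivAt (fun x : ℝ => Complex.I * (x : ℂ)) Complex.I x := by
        simpa using (Complex.ofRealCLM.hasDerivAt (x := x)).const_mul Complex.I
      rw [(h.cexp.const_mul (Complex.I ^ n)).deriv]
      ring
  refine ⟨?_, fun n => ⟨0, 1, fun x => ?_⟩⟩
  · have : ContDiff ℝ ∞ (fun x : ℝ => (x : ℂ)) := Complex.ofRealCLM.contDiff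
    fun_prop
  · rw [norm_iteratedFDeriv_eq_norm_iteratedDeriv, key]
    simp [mul_comm Complex.I, Complex.norm_exp_ofReal_mul_I]

lemma hasTemperateGrowth_coord {d : ℕ} (i : Fin d) : Function.HasTemperateGrowth (fun ξ : EuclideanSpace ℝ (Fin d) => ξ i) :=
  (EuclideanSpace.proj i : EuclideanSpace ℝ (Fin d) →L[ℝ] ℝ).hasTemperateGrowth

/-- The symbol is smooth of temperate growth, so that multiplication by it is defined on
tempered distributions. -/
lemma hasTemperateGrowth_propagatorSymbol {d : ℕ} [NeZero d] (α β γ t : ℝ) :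
    Function.HasTemperateGrowth (propagatorSymbol (d := d) α β γ t) := by
  have := hasTemperateGrowth_coord (0 : Fin d)
  have h : Function.HasTemperateGrowth (fun ξ : EuclideanSpace ℝ (Fin d) =>
      (α * ‖ξ‖ ^ 2 + β * ξ 0 ^ 3 + γ * ξ 0 ^ 4) * t) := by fun_prop
  exact hasTemperateGrowth_cexp_I_mul.comp h

/-- The propagator `W(t) = 𝓕⁻¹ e^{i (α |ξ|² + β ξ₁³ + γ ξ₁⁴) t} 𝓕`. -/
def propagator {d : ℕ} [NeZero d] (α β γ t : ℝ) :
    𝓢'(EuclideanSpace ℝ (Fin d), ℂ) →L[ℂ] 𝓢'(EuclideanSpace ℝ (Fin d), ℂ) :=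
  angularMultiplier (propagatorSymbol α β γ t)

open Classical in
/-- The decay rate `μ(d, γ, p)`; here `1/p = 0` for `p = ∞`. -/
def decayRate (d : ℕ) (γ : ℝ) (p : ℝ≥0∞) : ℝ :=
  if γ ≠ 0 then ((d : ℝ) - 1 / 2) * (1 / 2 - p⁻¹.toReal)
  else ((d : ℝ) - 1 / 3) * (1 / 2 - p⁻¹.toReal)

end

/-! On the frequency support of `□_k` the propagator agrees with a multiplier whose symbol is cut
off smoothly near `k`. It therefore suffices to bound each such multiplier from `L^{p'}` to `L^p`
with a constant independent of `k`; the weights and the `ℓ^q` norm then pass through unchanged.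

The localised operator is convolution with a Schwartz kernel. Its symbol is bounded by `1`, so
Plancherel gives an `L² → L²` bound with constant `1`. The sup norm of the kernel gives the `L¹ →
L^∞` bound. Interpolating yields the power `1 - 2/p` of the kernel bound
(`exists_eLpNorm_kernelConv_le`).

The phase is a sum of one-variable polynomials and the cut-off is a product, so the kernel
factorises into one-dimensional oscillatory integrals. Van der Corput's lemma
(`exists_norm_integral_cexp_le`) gives decay `|t|^{-1/n}` for a phase of degree `n`, uniformly in
position and in `k`: the `n`-th derivative of the phase is a constant multiple of `t`, and the
variation of the cut-off is translation invariant (`exists_norm_oscillatory_integral_le`). The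
degree is `2` in `d - 1` coordinates and `4` or `3` in the distinguished one, so the kernel decays
with exponent `(d - 1)/2 + 1/4` or `(d - 1)/2 + 1/3`; multiplication by `1 - 2/p` gives `μ`. -/

/-! ### Van der Corput estimates and one-dimensional dispersive decay. -/

open Polynomial in
lemma hasDerivAt_cexp_I_mul_eval (ψ : ℝ[X]) (x : ℝ) :
    HasDerivAt (fun x : ℝ => Complex.exp (Complex.I * (ψ.eval x : ℝ)))
      (Complex.I * (ψ.derivative.eval x : ℝ) * Complex.exp (Complex.I * (ψ.eval x : ℝ))) x := by
  have h := (((ψ.hasDerivAt x).ofReal_comp).const_mul Complex.I).cexp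
  convert! h using 1
  ring

lemma norm_cexp_I_mul_ofReal (y : ℝ) : ‖Complex.exp (Complex.I * (y : ℂ))‖ = 1 := by
  rw [mul_comm, Complex.norm_exp_ofReal_mul_I]

open Polynomial in
lemma continuous_cexp_I_mul_eval (ψ : ℝ[X]) :
    Continuous (fun x : ℝ => Complex.exp (Complex.I * (ψ.eval x : ℝ))) := by
  have := ψ.continuous
  fun_prop

open Polynomial in
/-- The first-derivative test for oscillatory integrals, with monotone `ψ'`. -/
lemma norm_integral_cexp_le_of_derivative_ge (ψ : ℝ[X]) {a b r s : ℝ} (hr : 0 < r) (hab : a ≤ b)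
    (hs : |s| = 1) (h1 : ∀ x ∈ Set.Icc a b, r ≤ ψ.derivative.eval x)
    (h2 : ∀ x ∈ Set.Icc a b, 0 ≤ s * ψ.derivative.derivative.eval x) :
    ‖∫ x in a..b, Complex.exp (Complex.I * (ψ.eval x : ℝ))‖ ≤ 3 / r := by
  set e : ℝ → ℂ := fun x => Complex.exp (Complex.I * (ψ.eval x : ℝ)) with he
  set p : ℝ → ℝ := fun x => ψ.derivative.eval x with hp
  set p' : ℝ → ℝ := fun x => ψ.derivative.derivative.eval x with hp'
  have huIcc : Set.uIcc a b = Set.Icc a b := Set.uIcc_of_le hab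
  have hpos : ∀ x ∈ Set.Icc a b, 0 < p x := fun x hx => hr.trans_le (h1 x hx)
  have hec : Continuous e := continuous_cexp_I_mul_eval ψ
  have hpc : Continuous p := ψ.derivative.continuous
  have hpc' : Continuous p' := ψ.derivative.derivative.continuous
  have hinv : ∀ x ∈ Set.Icc a b, HasDerivAt (fun x => (p x)⁻¹) (-p' x / p x ^ 2) x := fun x hx =>
    (ψ.derivative.hasDerivAt x).inv (hpos x hx).ne'
  -- Integration by parts: `i e = (e / ψ')' - (1 / ψ')' e`.
  have hG : ∀ x ∈ Set.uIcc a b, HasDerivAt (fun x => (((p x)⁻¹ : ℝ) : ℂ) * e x)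
      (((-p' x / p x ^ 2 : ℝ) : ℂ) * e x + Complex.I * e x) x := by
    intro x hx
    rw [huIcc] at hx
    convert! (hinv x hx).ofReal_comp.mul (hasDerivAt_cexp_I_mul_eval ψ x) using 1
    have : (p x : ℂ) ≠ 0 := by exact_mod_cast (hpos x hx).ne'
    simp only [he, hp] at this ⊢
    push_cast
    field_simp
  have hc1 : ContinuousOn (fun x => -p' x / p x ^ 2) (Set.uIcc a b) := by
    rw [huIcc]
    exact (hpc'.neg.continuousOn).div (hpc.pow 2).continuousOn
      (fun x hx => (pow_pos (hpos x hx) 2).ne')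
  have hi1 : IntervalIntegrable (fun x => ((-p' x / p x ^ 2 : ℝ) : ℂ) * e x) volume a b :=
    ((Complex.continuous_ofReal.comp_continuousOn hc1).mul hec.continuousOn).intervalIntegrable
  have hi2 : IntervalIntegrable (fun x => Complex.I * e x) volume a b :=
    (continuous_const.mul hec).intervalIntegrable _ _
  have key := intervalIntegral.integral_eq_sub_of_hasDerivAt hG (hi1.add hi2)
  rw [intervalIntegral.integral_add hi1 hi2, intervalIntegral.integral_const_mul] at key
  have hFTC := intervalIntegral.integral_eq_sub_of_hasDerivAt
    (fun x hx => hinv x (huIcc ▸ hx)) hc1.intervalIntegrable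
  -- Since `ψ''` keeps the sign `s`, the integral of `|(1 / ψ')'|` telescopes to a difference of two
  -- values of `1 / ψ'` in `(0, 1/r]`. The two boundary terms contribute the other `2 / r`.
  have hb1 : ‖∫ x in a..b, ((-p' x / p x ^ 2 : ℝ) : ℂ) * e x‖ ≤ 1 / r := by
    have : ‖∫ x in a..b, ((-p' x / p x ^ 2 : ℝ) : ℂ) * e x‖ ≤
        ∫ x in a..b, (-s) * (-p' x / p x ^ 2) := by
      refine intervalIntegral.norm_integral_le_of_norm_le hab (Filter.Eventually.of_forall ?_)
        (by simpa using (hc1.intervalIntegrable.const_mul (-s)))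
      intro x hx
      have hx' := Set.Ioc_subset_Icc_self hx
      rw [norm_mul, norm_cexp_I_mul_ofReal, mul_one, Complex.norm_real, Real.norm_eq_abs]
      have h3 : 0 ≤ (-s) * (-p' x / p x ^ 2) := by
        have := div_nonneg (h2 x hx') (sq_nonneg (p x))
        rwa [show -s * (-p' x / p x ^ 2) = s * p' x / p x ^ 2 by ring]
      rw [← abs_of_nonneg h3, abs_mul, abs_neg, hs, one_mul]
    refine this.trans ?_
    rw [intervalIntegral.integral_const_mul, hFTC]
    have ha := hpos a (Set.left_mem_Icc.2 hab)
    have hb := hpos b (Set.right_mem_Icc.2 hab)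
    have ha' := (inv_le_inv₀ ha hr).2 (h1 a (Set.left_mem_Icc.2 hab))
    have hb' := (inv_le_inv₀ hb hr).2 (h1 b (Set.right_mem_Icc.2 hab))
    have ha2 := (inv_pos.2 ha).le
    have hb2 := (inv_pos.2 hb).le
    calc (-s) * ((p b)⁻¹ - (p a)⁻¹) ≤ |(-s) * ((p b)⁻¹ - (p a)⁻¹)| := le_abs_self _
      _ = |(p b)⁻¹ - (p a)⁻¹| := by rw [abs_mul, abs_neg, hs, one_mul]
      _ ≤ 1 / r := by rw [one_div, abs_le]; constructor <;> linarith
  have hend : ∀ x ∈ Set.Icc a b, ‖(((p x)⁻¹ : ℝ) : ℂ) * e x‖ ≤ 1 / r := by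
    intro x hx
    rw [norm_mul, norm_cexp_I_mul_ofReal, mul_one, Complex.norm_real, Real.norm_eq_abs,
      abs_of_nonneg (inv_pos.2 (hpos x hx)).le, one_div]
    exact (inv_le_inv₀ (hpos x hx) hr).2 (h1 x hx)
  have : ‖Complex.I * ∫ x in a..b, e x‖ ≤ 3 / r := by
    rw [← eq_sub_iff_add_eq'] at key
    rw [key]
    have e1 := hend a (Set.left_mem_Icc.2 hab)
    have e2 := hend b (Set.right_mem_Icc.2 hab)
    have := norm_sub_le ((((p b)⁻¹ : ℝ) : ℂ) * e b - (((p a)⁻¹ : ℝ) : ℂ) * e a)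
      (∫ x in a..b, ((-p' x / p x ^ 2 : ℝ) : ℂ) * e x)
    have := norm_sub_le ((((p b)⁻¹ : ℝ) : ℂ) * e b) ((((p a)⁻¹ : ℝ) : ℂ) * e a)
    have h3 : 3 / r = 1 / r + 1 / r + 1 / r := by ring
    linarith
  rwa [norm_mul, Complex.norm_I, one_mul] at this

open Polynomial in
lemma norm_integral_cexp_neg (ψ : ℝ[X]) (a b : ℝ) :
    ‖∫ x in a..b, Complex.exp (Complex.I * ((-ψ).eval x : ℝ))‖ =
      ‖∫ x in a..b, Complex.exp (Complex.I * (ψ.eval x : ℝ))‖ := by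
  rw [← Complex.norm_conj, ← intervalIntegral.intervalIntegral_conj]
  congr 2 with x
  rw [← Complex.exp_conj]
  simp

/-- If `h` grows at rate at least `L`, then `{|h| < δ}` is an interval of length at most `2 δ / L`,
so an integral is controlled by its values on intervals on which `|h| ≥ δ`. -/
lemma norm_integral_le_of_expanding {F : ℝ → ℂ} {h : ℝ → ℝ} {a b L δ M : ℝ} (hab : a ≤ b)
    (hF : Continuous F) (hF1 : ∀ x, ‖F x‖ ≤ 1) (hh : Continuous h) (hL : 0 < L)
    (hexp : ∀ x ∈ Set.Icc a b, ∀ y ∈ Set.Icc a b, x ≤ y → L * (y - x) ≤ h y - h x)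
    (hM : 0 ≤ M) (hδ : 0 ≤ δ)
    (hpos : ∀ u v, a ≤ u → u ≤ v → v ≤ b → (∀ x ∈ Set.Icc u v, δ ≤ h x) →
      ‖∫ x in u..v, F x‖ ≤ M)
    (hneg : ∀ u v, a ≤ u → u ≤ v → v ≤ b → (∀ x ∈ Set.Icc u v, h x ≤ -δ) →
      ‖∫ x in u..v, F x‖ ≤ M) :
    ‖∫ x in a..b, F x‖ ≤ 2 * M + 2 * δ / L := by
  have hmono : ∀ x ∈ Set.Icc a b, ∀ y ∈ Set.Icc a b, x ≤ y → h x ≤ h y := fun x hx y hy hxy => by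
    nlinarith [hexp x hx y hy hxy]
  -- a threshold point for any level
  have thr : ∀ c : ℝ, ∃ u ∈ Set.Icc a b, (∀ x ∈ Set.Icc a b, x < u → h x ≤ c) ∧
      (∀ x ∈ Set.Icc a b, u < x → c ≤ h x) := by
    intro c
    by_cases h1 : c ≤ h a
    · exact ⟨a, Set.left_mem_Icc.2 hab, fun x hx hxa => absurd hxa (not_lt.2 hx.1),
        fun x hx _ => h1.trans (hmono _ (Set.left_mem_Icc.2 hab) _ hx hx.1)⟩
    by_cases h2 : h b ≤ c
    · exact ⟨b, Set.right_mem_Icc.2 hab, fun x hx _ =>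
        (hmono _ hx _ (Set.right_mem_Icc.2 hab) hx.2).trans h2,
        fun x hx hxa => absurd hxa (not_lt.2 hx.2)⟩
    obtain ⟨u, hu, rfl⟩ := intermediate_value_Icc hab hh.continuousOn
      ⟨(not_le.1 h1).le, (not_le.1 h2).le⟩
    exact ⟨u, hu, fun x hx hxu => hmono _ hx _ hu hxu.le, fun x hx hxu => hmono _ hu _ hx hxu.le⟩
  have clo_le : ∀ u v c, (∀ x ∈ Set.Ioo u v, h x ≤ c) → u < v → ∀ x ∈ Set.Icc u v, h x ≤ c := by
    intro u v c H huv x hx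
    have : Set.Icc u v ⊆ {x | h x ≤ c} := by
      rw [← closure_Ioo huv.ne]
      exact closure_minimal H (isClosed_le hh continuous_const)
    exact this hx
  have clo_ge : ∀ u v c, (∀ x ∈ Set.Ioo u v, c ≤ h x) → u < v → ∀ x ∈ Set.Icc u v, c ≤ h x := by
    intro u v c H huv x hx
    have : Set.Icc u v ⊆ {x | c ≤ h x} := by
      rw [← closure_Ioo huv.ne]
      exact closure_minimal H (isClosed_le continuous_const hh)
    exact this hx
  obtain ⟨u, hu, hu1, hu2⟩ := thr (-δ)
  obtain ⟨w, hw, hw1, hw2⟩ := thr δ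
  have hii : ∀ x y, IntervalIntegrable F volume x y := fun x y => hF.intervalIntegrable _ _
  have Ia : ‖∫ x in a..u, F x‖ ≤ M := by
    rcases hu.1.eq_or_lt with rfl | hlt
    · simpa using hM
    exact hneg a u le_rfl hu.1 hu.2 (clo_le _ _ _ (fun x hx =>
      hu1 x ⟨hx.1.le, hx.2.le.trans hu.2⟩ hx.2) hlt)
  have Ib : ∀ v ∈ Set.Icc a b, w ≤ v → ‖∫ x in v..b, F x‖ ≤ M := by
    intro v hv hwv
    rcases hv.2.eq_or_lt with rfl | hlt
    · simpa using hM
    exact hpos v b hv.1 hv.2 le_rfl (clo_ge _ _ _ (fun x hx =>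
      hw2 x ⟨hv.1.trans hx.1.le, hx.2.le⟩ (hwv.trans_lt hx.1)) hlt)
  have hδL : 0 ≤ 2 * δ / L := by positivity
  -- If `w ≤ u`, as when `h` stays above `δ` or below `-δ`, there is no middle interval to estimate.
  rcases le_or_gt w u with hwu | huw
  · rw [← intervalIntegral.integral_add_adjacent_intervals (hii a u) (hii u b)]
    refine (norm_add_le _ _).trans ?_
    have := Ib u hu hwu
    linarith
  · rw [← intervalIntegral.integral_add_adjacent_intervals (hii a u) (hii u b),
      ← intervalIntegral.integral_add_adjacent_intervals (hii u w) (hii w b)]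
    have hmid : ‖∫ x in u..w, F x‖ ≤ 2 * δ / L := by
      have h1 := intervalIntegral.norm_integral_le_of_norm_le_const (a := u) (b := w) (f := F)
        (C := 1) (fun x _ => hF1 x)
      rw [one_mul, abs_of_pos (sub_pos.2 huw)] at h1
      refine h1.trans ?_
      have h2 : -δ ≤ h u := clo_ge u w _ (fun x hx =>
        hu2 x ⟨hu.1.trans hx.1.le, hx.2.le.trans hw.2⟩ hx.1) huw u (Set.left_mem_Icc.2 huw.le)
      have h3 : h w ≤ δ := clo_le u w _ (fun x hx =>
        hw1 x ⟨hu.1.trans hx.1.le, hx.2.le.trans hw.2⟩ hx.2) huw w (Set.right_mem_Icc.2 huw.le)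
      rw [le_div_iff₀ hL]
      linarith [hexp u hu w hw huw.le]
    refine (norm_add_le _ _).trans ?_
    have := norm_add_le (∫ x in u..w, F x) (∫ x in w..b, F x)
    have := Ib w hw le_rfl
    linarith

open Polynomial in
lemma mul_sub_le_eval_sub_of_le_derivative (p : ℝ[X]) {a b L : ℝ}
    (hd : ∀ x ∈ Set.Icc a b, L ≤ p.derivative.eval x) :
    ∀ x ∈ Set.Icc a b, ∀ y ∈ Set.Icc a b, x ≤ y → L * (y - x) ≤ p.eval y - p.eval x :=
  (convex_Icc a b).mul_sub_le_image_sub_of_le_deriv p.continuous.continuousOn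
    p.differentiable.differentiableOn
    (fun x hx => by rw [p.deriv]; exact hd x (interior_subset hx))

open Polynomial in
/-- Van der Corput's lemma for polynomial phases: a lower bound `r ^ n` for the `n`-th derivative of
the phase, `n ≥ 2`, gives the bound `O (1 / r)` for the oscillatory integral. -/
theorem exists_norm_integral_cexp_le (n : ℕ) :
    ∃ C : ℝ, 0 ≤ C ∧ ∀ (ψ : ℝ[X]) (r a b : ℝ), 0 < r → a ≤ b →
      (∀ x ∈ Set.Icc a b, r ^ (n + 2) ≤ (derivative^[n + 2] ψ).eval x) →
      ‖∫ x in a..b, Complex.exp (Complex.I * (ψ.eval x : ℝ))‖ ≤ C / r := by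
  induction n with
  | zero =>
    -- `8 = 2 * 3 + 2`: the first-derivative bound `3 / r` on either side of `{|ψ'| < r}`, and
    -- length at most `2 r / r²` for that set.
    refine ⟨8, by norm_num, fun ψ r a b hr hab H => ?_⟩
    simp only [zero_add, Function.iterate_succ, Function.iterate_zero, Function.comp, id] at H
    have hd : ∀ x ∈ Set.Icc a b, 0 ≤ ψ.derivative.derivative.eval x :=
      fun x hx => (pow_pos hr 2).le.trans (H x hx)
    have := norm_integral_le_of_expanding (F := fun x => Complex.exp (Complex.I * (ψ.eval x : ℝ)))
      (h := fun x => ψ.derivative.eval x) (L := r ^ 2) (δ := r) (M := 3 / r) hab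
      (continuous_cexp_I_mul_eval ψ) (fun x => (norm_cexp_I_mul_ofReal _).le)
      ψ.derivative.continuous (by positivity) (mul_sub_le_eval_sub_of_le_derivative _ H)
      (by positivity) hr.le
      (fun u v hu huv hv h => norm_integral_cexp_le_of_derivative_ge ψ (s := 1) hr huv (by simp) h
        (fun x hx => by simpa using hd x ⟨hu.trans hx.1, hx.2.trans hv⟩))
      (fun u v hu huv hv h => by
        rw [← norm_integral_cexp_neg]
        refine norm_integral_cexp_le_of_derivative_ge (-ψ) (s := -1) hr huv (by simp)
          (fun x hx => by simpa using le_neg_of_le_neg (h x hx))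
          (fun x hx => by simpa using hd x ⟨hu.trans hx.1, hx.2.trans hv⟩))
    refine this.trans (le_of_eq ?_)
    field_simp
    norm_num
  | succ n ih =>
    obtain ⟨C, hC, ih⟩ := ih
    -- Threshold `r ^ (n + 2)` against growth rate `r ^ (n + 3)` again leaves an exceptional
    -- interval of length at most `2 / r`.
    refine ⟨2 * C + 2, by positivity, fun ψ r a b hr hab H => ?_⟩
    rw [show n + 1 + 2 = (n + 2) + 1 by ring] at H
    simp only [Function.iterate_succ_apply' (n := n + 2)] at H
    have := norm_integral_le_of_expanding (F := fun x => Complex.exp (Complex.I * (ψ.eval x : ℝ)))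
      (h := fun x => (derivative^[n + 2] ψ).eval x) (L := r ^ (n + 2 + 1)) (δ := r ^ (n + 2))
      (M := C / r) hab
      (continuous_cexp_I_mul_eval ψ) (fun x => (norm_cexp_I_mul_ofReal _).le)
      (Polynomial.continuous _) (by positivity) (mul_sub_le_eval_sub_of_le_derivative _ H)
      (by positivity) (by positivity)
      (fun u v hu huv hv h => ih ψ r u v hr huv h)
      (fun u v hu huv hv h => by
        rw [← norm_integral_cexp_neg]
        refine ih (-ψ) r u v hr huv (fun x hx => ?_)
        rw [iterate_derivative_neg]
        simpa using le_neg_of_le_neg (h x hx))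
    refine this.trans (le_of_eq ?_)
    rw [pow_succ r (n + 2)]
    field_simp

/-- Van der Corput's lemma with a compactly supported amplitude, by parts. -/
lemma norm_integral_mul_le_of_forall_intervalIntegral_le {e χ : ℝ → ℂ} {M : ℝ} (he : Continuous e)
    (hM : ∀ u v, u ≤ v → ‖∫ x in u..v, e x‖ ≤ M) (hχ : ContDiff ℝ 1 χ) (hc : HasCompactSupport χ) :
    ‖∫ x, e x * χ x‖ ≤ M * ∫ x, ‖deriv χ x‖ := by
  set F : ℝ → ℂ := fun x => ∫ y in (0 : ℝ)..x, e y with hFdef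
  have hF : ∀ x, HasDerivAt F (e x) x := fun x =>
    intervalIntegral.integral_hasDerivAt_right (he.intervalIntegrable _ _)
      he.aestronglyMeasurable.stronglyMeasurableAtFilter he.continuousAt
  have hFM : ∀ x, ‖F x‖ ≤ M := by
    intro x
    rcases le_total 0 x with h | h
    · exact hM 0 x h
    · simp only [hFdef]
      rw [intervalIntegral.integral_symm, norm_neg]
      exact hM x 0 h
  have hFc : Continuous F := continuous_iff_continuousAt.2 fun x => (hF x).continuousAt
  have hχd : ∀ x, HasDerivAt χ (deriv χ x) x := fun x =>
    ((hχ.differentiable one_ne_zero) x).hasDerivAt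
  have hχ'c : Continuous (deriv χ) := hχ.continuous_deriv le_rfl
  have hint := integral_mul_deriv_eq_deriv_mul_of_integrable (u := F) (v := χ) (fun x _ => hF x)
    (fun x _ => hχd x)
    ((hFc.mul hχ'c).integrable_of_hasCompactSupport hc.deriv.mul_left)
    ((he.mul hχ.continuous).integrable_of_hasCompactSupport hc.mul_left)
    ((hFc.mul hχ.continuous).integrable_of_hasCompactSupport hc.mul_left)
  have h2 : ‖∫ x, e x * χ x‖ = ‖∫ x, F x * deriv χ x‖ := by rw [hint, norm_neg]
  rw [h2, ← integral_const_mul]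
  refine norm_integral_le_of_norm_le
    ((hχ'c.integrable_of_hasCompactSupport hc.deriv).norm.const_mul M) (.of_forall fun x => ?_)
  rw [norm_mul]
  exact mul_le_mul_of_nonneg_right (hFM x) (norm_nonneg _)

-- The top derivative is constant, so the van der Corput lower bound holds on every interval,
-- wherever the frequency window sits.
open Polynomial in
lemma iterate_derivative_natDegree_eval (ψ : ℝ[X]) (n : ℕ) (hn : ψ.natDegree ≤ n) (x : ℝ) :
    (derivative^[n] ψ).eval x = n.factorial * ψ.coeff n := by
  have h : (derivative^[n] ψ).natDegree = 0 := by
    have := natDegree_iterate_derivative ψ n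
    omega
  rw [eq_C_of_natDegree_eq_zero h, coeff_iterate_derivative, eval_C]
  simp [Nat.descFactorial_self]

open Polynomial in
/-- Dispersive decay in one dimension: for a phase `P` of degree `n ≥ 2`, the frequency-localised
oscillatory integral decays like `(1 + |t|) ^ (-1 / n)`, uniformly in position and in the centre of
the frequency window. -/
theorem exists_norm_oscillatory_integral_le (P : ℝ[X]) (hP : 2 ≤ P.natDegree) {χ : ℝ → ℂ}
    (hχ : ContDiff ℝ 1 χ) (hc : HasCompactSupport χ) :
    ∃ C : ℝ, 0 < C ∧ ∀ t y κ : ℝ,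
      ‖∫ ξ : ℝ, Complex.exp (Complex.I * ((y * ξ + t * P.eval ξ : ℝ) : ℂ)) * χ (ξ - κ)‖ ≤
        C * (1 + |t|) ^ (-(1 / (P.natDegree : ℝ))) := by
  obtain ⟨m, hm⟩ := Nat.exists_eq_add_of_le' hP
  obtain ⟨C₀, hC₀, hvdc⟩ := exists_norm_integral_cexp_le m
  set n := P.natDegree with hn
  set ν : ℝ := 1 / (n : ℝ) with hν
  have hn0 : (0 : ℝ) < n := by exact_mod_cast (by omega : 0 < n)
  have hν0 : 0 < ν := by positivity
  set a := P.leadingCoeff with ha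
  have ha0 : a ≠ 0 := by
    rw [ha, Ne, leadingCoeff_eq_zero]
    intro h
    have : n = 0 := by rw [hn, h, natDegree_zero]
    omega
  set A : ℝ := ∫ ξ, ‖χ ξ‖ with hA
  set B : ℝ := ∫ ξ, ‖deriv χ ξ‖ with hB
  have hA0 : 0 ≤ A := integral_nonneg fun _ => norm_nonneg _
  have hB0 : 0 ≤ B := integral_nonneg fun _ => norm_nonneg _
  set D : ℝ := n.factorial * |a| / 2 with hD
  have hD0 : 0 < D := by
    have := abs_pos.2 ha0
    have : (0 : ℝ) < n.factorial := by exact_mod_cast n.factorial_pos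
    positivity
  -- The first summand serves `|t| ≤ 1`, where the trivial bound `A` is enough; the second serves
  -- `|t| > 1`, where `|t| ≥ (1 + |t|) / 2` accounts for the half in `D`. The final `1` only makes
  -- the constant positive.
  refine ⟨A * 2 ^ ν + C₀ * D ^ (-ν) * B + 1, by positivity, fun t y κ => ?_⟩
  have ht1 : 0 < 1 + |t| := by positivity
  set T := (1 + |t|) ^ (-ν) with hT
  have hT0 : 0 < T := by positivity
  set ψ : ℝ[X] := C y * X + C t * P with hψ
  have hψe : ∀ ξ, ψ.eval ξ = y * ξ + t * P.eval ξ := fun ξ => by simp [hψ]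
  simp_rw [← hψe]
  have hχκ : ContDiff ℝ 1 (fun ξ => χ (ξ - κ)) := hχ.comp (contDiff_id.sub contDiff_const)
  have hcκ : HasCompactSupport (fun ξ => χ (ξ - κ)) :=
    hc.comp_homeomorph (Homeomorph.subRight κ)
  rcases le_or_gt |t| 1 with htl | htl
  · have h1 : ‖∫ ξ : ℝ, Complex.exp (Complex.I * ((ψ.eval ξ : ℝ) : ℂ)) * χ (ξ - κ)‖ ≤ A := by
      refine (norm_integral_le_integral_norm _).trans (le_of_eq ?_)
      simp_rw [norm_mul, norm_cexp_I_mul_ofReal, one_mul]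
      exact integral_sub_right_eq_self (fun ξ => ‖χ ξ‖) κ
    have h2 : 1 ≤ 2 ^ ν * T := by
      rw [hT, Real.rpow_neg ht1.le, ← div_eq_mul_inv, one_le_div (by positivity)]
      exact Real.rpow_le_rpow ht1.le (by linarith) hν0.le
    calc _ ≤ A := h1
      _ ≤ A * (2 ^ ν * T) := le_mul_of_one_le_right hA0 h2
      _ ≤ _ := by
        have : 0 ≤ (C₀ * D ^ (-ν) * B + 1) * T := by positivity
        linarith
  · have hdeg : ψ.natDegree ≤ n := by
      refine (natDegree_add_le _ _).trans (max_le ?_ (natDegree_C_mul_le _ _))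
      exact (natDegree_C_mul_le _ _).trans (natDegree_X_le.trans (by omega))
    -- As `n ≥ 2`, the linear term `y ξ` does not reach the top coefficient; hence the uniformity in
    -- `y`.
    have hcoeff : ψ.coeff n = t * a := by
      rw [hψ, coeff_add, coeff_C_mul, coeff_C_mul, coeff_X, if_neg (by omega), mul_zero, zero_add,
        ha, leadingCoeff, hn]
    set r : ℝ := (n.factorial * |a| * |t|) ^ ν with hr
    have hbase : 0 < n.factorial * |a| * |t| := by
      have : 0 < |t| := by linarith
      have : 0 < n.factorial * |a| := by linarith
      positivity
    have hr0 : 0 < r := by positivity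
    have hrn : r ^ (m + 2) = n.factorial * |a| * |t| := by
      rw [hr, ← hm, ← Real.rpow_natCast, ← Real.rpow_mul hbase.le, hν, one_div_mul_cancel hn0.ne',
        Real.rpow_one]
    have hbd : ∀ u v, u ≤ v →
        ‖∫ x in u..v, Complex.exp (Complex.I * (ψ.eval x : ℝ))‖ ≤ C₀ / r := by
      intro u v huv
      rcases le_total 0 (t * a) with h | h
      · refine hvdc ψ r u v hr0 huv (fun x _ => ?_)
        rw [hrn, ← hm, iterate_derivative_natDegree_eval ψ n hdeg, hcoeff, mul_assoc, ← abs_mul,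
          mul_comm a t, abs_of_nonneg h]
      · rw [← norm_integral_cexp_neg]
        refine hvdc (-ψ) r u v hr0 huv (fun x _ => ?_)
        rw [hrn, ← hm, iterate_derivative_natDegree_eval (-ψ) n (by rwa [natDegree_neg]), coeff_neg,
          hcoeff, mul_assoc, ← abs_mul, mul_comm a t, abs_of_nonpos h]
    have h1 := norm_integral_mul_le_of_forall_intervalIntegral_le
      (continuous_cexp_I_mul_eval ψ) hbd hχκ hcκ
    have h2 : ∫ x, ‖deriv (fun ξ => χ (ξ - κ)) x‖ = B := by
      simp_rw [deriv_comp_sub_const]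
      exact integral_sub_right_eq_self (fun ξ => ‖deriv χ ξ‖) κ
    rw [h2] at h1
    have h3 : 1 / r ≤ D ^ (-ν) * T := by
      rw [hT, ← Real.mul_rpow hD0.le ht1.le, one_div, hr, ← Real.rpow_neg hbase.le]
      refine Real.rpow_le_rpow_of_nonpos (by positivity) ?_ (by linarith)
      rw [hD]
      have : 0 < n.factorial * |a| := by linarith
      nlinarith
    calc _ ≤ C₀ / r * B := h1
      _ = C₀ * B * (1 / r) := by ring
      _ ≤ C₀ * B * (D ^ (-ν) * T) := by gcongr
      _ ≤ _ := by
        have : 0 ≤ (A * 2 ^ ν + 1) * T := by positivity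
        linarith

/-! ### Real interpolation between `L¹ → L^∞` and `L² → L²`. -/

lemma enorm_rpow_eq_ofReal {E : Type*} [SeminormedAddCommGroup E] (z : E) {p : ℝ} (hp : 0 ≤ p) :
    ‖z‖ₑ ^ p = ENNReal.ofReal (‖z‖ ^ p) := by
  rw [← ofReal_norm, ENNReal.ofReal_rpow_of_nonneg (norm_nonneg z) hp]

/-- `∫ 1_{y ≤ (c/s)^{p-1}} s^{p-3} ds`, weighted by `y²`. -/
lemma sq_mul_lintegral_indicator_rpow {p c y : ℝ} (hp : 2 < p) (hc : 0 < c) (hy : 0 ≤ y) :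
    ∫⁻ s in Set.Ioi (0 : ℝ), (if y ≤ (c / s) ^ (p - 1) then ENNReal.ofReal (y ^ 2) else 0) *
        ENNReal.ofReal (s ^ (p - 3)) =
      ENNReal.ofReal (c ^ (p - 2) / (p - 2)) * ENNReal.ofReal (y ^ (p / (p - 1))) := by
  have hp1 : 0 < p - 1 := by linarith
  have hp2 : 0 < p - 2 := by linarith
  rcases hy.eq_or_lt with rfl | hy
  · have : p / (p - 1) ≠ 0 := (div_pos (by linarith) hp1).ne'
    simp [Real.zero_rpow this]
  -- `S` solves `y = (c / s) ^ (p - 1)` for `s`, so the indicator restricts the integral to `s ≤ S`.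
  set S : ℝ := c * y ^ (-(1 / (p - 1))) with hS
  have hS0 : 0 < S := by positivity
  have hiff : ∀ s : ℝ, 0 < s → (y ≤ (c / s) ^ (p - 1) ↔ s ≤ S) := by
    intro s hs
    have h1 : y ≤ (c / s) ^ (p - 1) ↔ y ^ (1 / (p - 1)) ≤ c / s := by
      rw [← Real.rpow_le_rpow_iff (x := y ^ (1 / (p - 1))) (z := p - 1) (by positivity)
        (by positivity) hp1, ← Real.rpow_mul hy.le, one_div_mul_cancel hp1.ne', Real.rpow_one]
    rw [h1, hS, Real.rpow_neg hy.le, ← div_eq_mul_inv, le_div_iff₀ hs,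
      le_div_iff₀ (by positivity), mul_comm]
  have h1 : ∫⁻ s in Set.Ioi (0 : ℝ), (if y ≤ (c / s) ^ (p - 1) then ENNReal.ofReal (y ^ 2) else 0) *
        ENNReal.ofReal (s ^ (p - 3)) =
      ∫⁻ s in Set.Ioi (0 : ℝ), (Set.Iic S).indicator
        (fun s => ENNReal.ofReal (y ^ 2) * ENNReal.ofReal (s ^ (p - 3))) s := by
    refine setLIntegral_congr_fun measurableSet_Ioi (fun s hs => ?_)
    simp only [hiff s hs, Set.indicator, Set.mem_Iic, ite_mul, zero_mul]
  have hint : IntervalIntegrable (fun s : ℝ => s ^ (p - 3)) volume 0 S :=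
    intervalIntegral.intervalIntegrable_rpow' (by linarith)
  have h2 : ∫⁻ s in Set.Ioc 0 S, ENNReal.ofReal (s ^ (p - 3)) =
      ENNReal.ofReal (S ^ (p - 2) / (p - 2)) := by
    rw [← ofReal_integral_eq_lintegral_ofReal
      ((intervalIntegrable_iff_integrableOn_Ioc_of_le hS0.le).1 hint)
      ((ae_restrict_mem measurableSet_Ioc).mono fun s hs => Real.rpow_nonneg hs.1.le _),
      ← intervalIntegral.integral_of_le hS0.le, integral_rpow (Or.inl (by linarith))]
    rw [show p - 3 + 1 = p - 2 by ring, Real.zero_rpow hp2.ne', sub_zero]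
  rw [h1, setLIntegral_indicator measurableSet_Iic, Set.Iic_inter_Ioi,
    lintegral_const_mul _ (by fun_prop), h2, ← ENNReal.ofReal_mul (by positivity),
    ← ENNReal.ofReal_mul (by positivity)]
  congr 1
  rw [hS, Real.mul_rpow hc.le (by positivity), ← Real.rpow_mul hy.le]
  have : y ^ 2 * y ^ (-(1 / (p - 1)) * (p - 2)) = y ^ (p / (p - 1)) := by
    rw [← Real.rpow_natCast y 2, ← Real.rpow_add hy]
    congr 1
    field_simp
    push_cast
    ring
  rw [← this]
  ring

/-- Real interpolation between an `L¹ → L^∞` bound with constant `A` and an `L² → L²` bound with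
constant `1`: the hypothesis is the pair of bounds for the two halves of each truncation of `f`. -/
theorem eLpNorm_le_of_truncation {α β E F : Type*} [MeasurableSpace α] [MeasurableSpace β]
    [NormedAddCommGroup E] [NormedAddCommGroup F]
    {μ : Measure α} {ν : Measure β} [SFinite μ] {f : α → E} {G : β → F} {p A : ℝ}
    (hp : 2 < p) (hA : 0 < A) (hfm : StronglyMeasurable f)
    (hf : MemLp f (ENNReal.ofReal (p / (p - 1))) μ) (hG : AEStronglyMeasurable G ν)
    (H : ∀ l : ℝ, 0 < l → ∃ G₁ G₂ : β → F, AEStronglyMeasurable G₂ ν ∧ G =ᵐ[ν] G₁ + G₂ ∧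
      (∀ᵐ y ∂ν, ‖G₁ y‖ₑ ≤ ENNReal.ofReal A * ∫⁻ x in {x | l < ‖f x‖}, ‖f x‖ₑ ∂μ) ∧
      ∫⁻ y, ‖G₂ y‖ₑ ^ 2 ∂ν ≤ ∫⁻ x in {x | ‖f x‖ ≤ l}, ‖f x‖ₑ ^ 2 ∂μ) :
    eLpNorm G (ENNReal.ofReal p) ν ≤
      ENNReal.ofReal ((4 * p / (p - 2) * 2 ^ (p - 2)) ^ (1 / p) * A ^ (1 - 2 / p)) *
        eLpNorm f (ENNReal.ofReal (p / (p - 1))) μ := by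
  have hp0 : 0 < p := by linarith
  have hp1 : 0 < p - 1 := by linarith
  have hp2 : 0 < p - 2 := by linarith
  set p' := p / (p - 1) with hp'
  have hp'0 : 0 < p' := by positivity
  have hp'1 : 0 < p' - 1 := by
    rw [hp', div_sub_one hp1.ne']
    exact div_pos (by linarith) hp1
  have hmul : (p - 1) * (1 - p') = -1 := by
    rw [hp']
    field_simp
    ring
  have hpE0 : ENNReal.ofReal p ≠ 0 := by simpa using hp0
  have hp'E0 : ENNReal.ofReal p' ≠ 0 := by simpa using hp'0
  set N := ∫⁻ x, ‖f x‖ₑ ^ p' ∂μ with hN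
  have hNf : eLpNorm f (ENNReal.ofReal p') μ = N ^ (1 / p') := by
    rw [eLpNorm_eq_lintegral_rpow_enorm_toReal hp'E0 ENNReal.ofReal_ne_top,
      ENNReal.toReal_ofReal hp'0.le]
  have hNtop : N ≠ ⊤ := by
    intro h
    have := hf.2
    rw [hNf, h, ENNReal.top_rpow_of_pos (by positivity)] at this
    exact absurd this (lt_irrefl _)
  -- The case `f = 0` almost everywhere is separate, because the truncation levels below would
  -- degenerate to `0`.
  rcases eq_or_ne N 0 with hN0 | hN0
  · have hf0 : ∀ᵐ x ∂μ, f x = 0 := by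
      have h1 := (lintegral_eq_zero_iff' (by
        exact (hfm.enorm.pow_const p').aemeasurable)).1 hN0
      filter_upwards [h1] with x hx
      have hx' : ‖f x‖ₑ ^ p' = 0 := hx
      rwa [ENNReal.rpow_eq_zero_iff_of_pos hp'0, enorm_eq_zero] at hx'
    obtain ⟨G₁, G₂, hG₂, hGG, h1, h2⟩ := H 1 one_pos
    have e1 : ∫⁻ x in {x | 1 < ‖f x‖}, ‖f x‖ₑ ∂μ = 0 := by
      refine (lintegral_congr_ae (ae_restrict_of_ae ?_)).trans lintegral_zero
      filter_upwards [hf0] with x hx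
      simp [hx]
    have e2 : ∫⁻ x in {x | ‖f x‖ ≤ 1}, ‖f x‖ₑ ^ 2 ∂μ = 0 := by
      refine (lintegral_congr_ae (ae_restrict_of_ae ?_)).trans lintegral_zero
      filter_upwards [hf0] with x hx
      simp [hx]
    rw [e1, mul_zero] at h1
    rw [e2] at h2
    have h3 := (lintegral_eq_zero_iff' (hG₂.enorm.pow_const 2)).1 (le_antisymm h2 bot_le)
    have : G =ᵐ[ν] 0 := by
      filter_upwards [hGG, h1, h3] with y hy h1y h3y
      have h4 : G₁ y = 0 := by simpa using h1y
      have h5 : G₂ y = 0 := by simpa using h3y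
      rw [hy]
      simp [h4, h5]
    rw [eLpNorm_congr_ae this]
    simp
  set M := N.toReal with hM
  have hM0 : 0 < M := ENNReal.toReal_pos hN0 hNtop
  have hNM : N = ENNReal.ofReal M := (ENNReal.ofReal_toReal hNtop).symm
  -- With this `c`, truncating at the `s`-dependent level `(c / s) ^ (p - 1)` makes the large part
  -- of `f` contribute at most `s / 2` to `G`.
  set c := 2 * A * M with hc
  have hc0 : 0 < c := by positivity
  -- the distribution function of `G`
  have hdist : ∀ s : ℝ, 0 < s → ν {y | s < ‖G y‖} ≤
      ENNReal.ofReal (4 / s ^ 2) * ∫⁻ x, (if ‖f x‖ ≤ (c / s) ^ (p - 1) then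
        ENNReal.ofReal (‖f x‖ ^ 2) else 0) ∂μ := by
    intro s hs
    set l := (c / s) ^ (p - 1) with hl
    have hl0 : 0 < l := by positivity
    obtain ⟨G₁, G₂, hG₂, hGG, h1, h2⟩ := H l hl0
    have hl1 : l ^ (1 - p') = s / c := by
      rw [hl, ← Real.rpow_mul (by positivity), hmul, Real.rpow_neg_one, inv_div]
    have hb : ∫⁻ x in {x | l < ‖f x‖}, ‖f x‖ₑ ∂μ ≤ ENNReal.ofReal (s / c) * N := by
      calc ∫⁻ x in {x | l < ‖f x‖}, ‖f x‖ₑ ∂μ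
          ≤ ∫⁻ x in {x | l < ‖f x‖}, ENNReal.ofReal (s / c) * ‖f x‖ₑ ^ p' ∂μ := by
            refine setLIntegral_mono (by
              exact (hfm.enorm.pow_const p').const_mul _) (fun x hx => ?_)
            have hx' : l < ‖f x‖ := hx
            have hfx : 0 < ‖f x‖ := hl0.trans hx'
            rw [enorm_rpow_eq_ofReal _ hp'0.le, ← ENNReal.ofReal_mul (by positivity), ← ofReal_norm]
            refine ENNReal.ofReal_le_ofReal ?_
            calc ‖f x‖ = ‖f x‖ ^ (1 - p') * ‖f x‖ ^ p' := by
                  rw [← Real.rpow_add hfx]; simp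
              _ ≤ l ^ (1 - p') * ‖f x‖ ^ p' := by
                  refine mul_le_mul_of_nonneg_right ?_ (by positivity)
                  exact Real.rpow_le_rpow_of_nonpos hl0 hx'.le (by linarith)
              _ = _ := by rw [hl1]
        _ ≤ ∫⁻ x, ENNReal.ofReal (s / c) * ‖f x‖ₑ ^ p' ∂μ := setLIntegral_le_lintegral _ _
        _ = _ := lintegral_const_mul _ (hfm.enorm.pow_const p')
    have hb' : ENNReal.ofReal A * ∫⁻ x in {x | l < ‖f x‖}, ‖f x‖ₑ ∂μ ≤ ENNReal.ofReal (s / 2) := by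
      refine (mul_le_mul_right hb _).trans (le_of_eq ?_)
      rw [hNM, ← ENNReal.ofReal_mul (by positivity), ← ENNReal.ofReal_mul hA.le]
      congr 1
      rw [hc]
      field_simp
    -- Only `G₂` can carry `|G|` beyond `s`; Chebyshev in `L²` at height `s / 2` then gives the
    -- factor `4 / s ^ 2`.
    have hsub : ν {y | s < ‖G y‖} ≤ ν {y | ENNReal.ofReal ((s / 2) ^ 2) ≤ ‖G₂ y‖ₑ ^ 2} := by
      refine measure_mono_ae ?_
      filter_upwards [hGG, h1] with y hy h1y hsy
      have hsy' : s < ‖G y‖ := hsy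
      have h3 : ‖G₁ y‖ ≤ s / 2 := by
        rw [← ENNReal.ofReal_le_ofReal_iff (by positivity), ofReal_norm]
        exact h1y.trans hb'
      have h4 : ‖G y‖ ≤ ‖G₁ y‖ + ‖G₂ y‖ := by
        rw [hy]
        exact norm_add_le _ _
      change ENNReal.ofReal ((s / 2) ^ 2) ≤ ‖G₂ y‖ₑ ^ 2
      rw [← ofReal_norm, ← ENNReal.ofReal_pow (norm_nonneg _)]
      exact ENNReal.ofReal_le_ofReal (pow_le_pow_left₀ (by positivity) (by linarith) 2)
    have hcheb := mul_meas_ge_le_lintegral₀ (hG₂.enorm.pow_const 2)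
      (ENNReal.ofReal ((s / 2) ^ 2))
    have hset : MeasurableSet {x | ‖f x‖ ≤ l} :=
      measurableSet_le hfm.norm.measurable measurable_const
    have h5 : ∫⁻ x in {x | ‖f x‖ ≤ l}, ‖f x‖ₑ ^ 2 ∂μ = ∫⁻ x, (if ‖f x‖ ≤ l then
        ENNReal.ofReal (‖f x‖ ^ 2) else 0) ∂μ := by
      rw [← lintegral_indicator hset]
      refine lintegral_congr fun x => ?_
      simp only [Set.indicator, Set.mem_ofPred_eq]
      rw [← ofReal_norm, ENNReal.ofReal_pow (norm_nonneg _)]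
    rw [← h5]
    calc ν {y | s < ‖G y‖}
        ≤ ν {y | ENNReal.ofReal ((s / 2) ^ 2) ≤ ‖G₂ y‖ₑ ^ 2} := hsub
      _ = ENNReal.ofReal (4 / s ^ 2) * (ENNReal.ofReal ((s / 2) ^ 2) *
            ν {y | ENNReal.ofReal ((s / 2) ^ 2) ≤ ‖G₂ y‖ₑ ^ 2}) := by
          rw [← mul_assoc, ← ENNReal.ofReal_mul (by positivity)]
          rw [show 4 / s ^ 2 * (s / 2) ^ 2 = 1 by field_simp; norm_num]
          simp
      _ ≤ _ := mul_le_mul_right (hcheb.trans h2) _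
  have hmeas : Measurable (fun z : ℝ × α => (if ‖f z.2‖ ≤ (c / z.1) ^ (p - 1) then
        ENNReal.ofReal (‖f z.2‖ ^ 2) else 0) * ENNReal.ofReal (z.1 ^ (p - 3))) := by
    have hfn : Measurable (fun z : ℝ × α => ‖f z.2‖) := hfm.norm.measurable.comp measurable_snd
    refine Measurable.mul (Measurable.ite (measurableSet_le hfn (by fun_prop)) ?_ measurable_const)
      (by fun_prop)
    fun_prop
  have hmain : ∫⁻ y, ‖G y‖ₑ ^ p ∂ν ≤
      ENNReal.ofReal (4 * p / (p - 2) * c ^ (p - 2)) * N := by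
    simp_rw [enorm_rpow_eq_ofReal _ hp0.le]
    rw [lintegral_rpow_eq_lintegral_meas_lt_mul ν (.of_forall fun _ => norm_nonneg _)
      hG.norm.aemeasurable hp0]
    calc ENNReal.ofReal p * ∫⁻ s in Set.Ioi 0, ν {y | s < ‖G y‖} * ENNReal.ofReal (s ^ (p - 1))
        ≤ ENNReal.ofReal p * ∫⁻ s in Set.Ioi (0 : ℝ), ENNReal.ofReal 4 *
            ∫⁻ x, (if ‖f x‖ ≤ (c / s) ^ (p - 1) then
              ENNReal.ofReal (‖f x‖ ^ 2) else 0) * ENNReal.ofReal (s ^ (p - 3)) ∂μ := by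
          refine mul_le_mul_right (setLIntegral_mono' measurableSet_Ioi fun s hs => ?_) _
          have hs' : 0 < s := hs
          have hms : Measurable (fun x => if ‖f x‖ ≤ (c / s) ^ (p - 1) then
              ENNReal.ofReal (‖f x‖ ^ 2) else 0) := by
            have hfn : Measurable (fun x => ‖f x‖) := hfm.norm.measurable
            exact Measurable.ite (measurableSet_le hfn measurable_const) (by fun_prop)
              measurable_const
          rw [lintegral_mul_const _ hms]
          refine (mul_le_mul_left (hdist s hs') _).trans (le_of_eq ?_)
          have : ENNReal.ofReal (4 / s ^ 2) * ENNReal.ofReal (s ^ (p - 1)) =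
              ENNReal.ofReal 4 * ENNReal.ofReal (s ^ (p - 3)) := by
            rw [← ENNReal.ofReal_mul (by positivity), ← ENNReal.ofReal_mul (by positivity)]
            congr 1
            rw [show p - 1 = (p - 3) + (2 : ℕ) by push_cast; ring, Real.rpow_add hs',
              Real.rpow_natCast]
            field_simp
          rw [mul_right_comm, this]
          ring
      -- Tonelli: for fixed `x` the `s`-integral is explicit and produces exactly `|f x| ^ p'`.
      _ = ENNReal.ofReal p * (ENNReal.ofReal 4 * ∫⁻ x, (∫⁻ s in Set.Ioi (0 : ℝ),
            (if ‖f x‖ ≤ (c / s) ^ (p - 1) then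
              ENNReal.ofReal (‖f x‖ ^ 2) else 0) * ENNReal.ofReal (s ^ (p - 3))) ∂μ) := by
          rw [lintegral_const_mul _ hmeas.lintegral_prod_right',
            lintegral_lintegral_swap hmeas.aemeasurable]
      _ = ENNReal.ofReal p * (ENNReal.ofReal 4 *
            (ENNReal.ofReal (c ^ (p - 2) / (p - 2)) * N)) := by
          simp_rw [sq_mul_lintegral_indicator_rpow hp hc0 (norm_nonneg _),
            ← enorm_rpow_eq_ofReal _ (div_pos hp0 hp1).le]
          rw [lintegral_const_mul _ (hfm.enorm.pow_const _)]
      _ = _ := by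
          rw [← mul_assoc, ← mul_assoc, ← ENNReal.ofReal_mul (by positivity),
            ← ENNReal.ofReal_mul (by positivity)]
          congr 2
          ring
  rw [hNf, eLpNorm_eq_lintegral_rpow_enorm_toReal hpE0 ENNReal.ofReal_ne_top,
      ENNReal.toReal_ofReal hp0.le]
  refine (ENNReal.rpow_le_rpow hmain (by positivity)).trans (le_of_eq ?_)
  rw [hNM, ← ENNReal.ofReal_mul (by positivity), ENNReal.ofReal_rpow_of_nonneg (by positivity)
    (by positivity), ENNReal.ofReal_rpow_of_nonneg (by positivity)
    (by positivity), ← ENNReal.ofReal_mul (by positivity)]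
  congr 1
  have e1 : 4 * p / (p - 2) * c ^ (p - 2) * M =
      (4 * p / (p - 2) * 2 ^ (p - 2)) * A ^ (p - 2) * M ^ (p - 1) := by
    rw [hc, Real.mul_rpow (by positivity) hM0.le, Real.mul_rpow (by norm_num) hA.le,
      show p - 1 = (p - 2) + 1 by ring, Real.rpow_add_one hM0.ne']
    ring
  have e2 : (p - 2) * (1 / p) = 1 - 2 / p := by field_simp
  have e3 : (p - 1) * (1 / p) = 1 / p' := by
    rw [hp']
    field_simp
  rw [e1, Real.mul_rpow (by positivity) (by positivity),
    Real.mul_rpow (by positivity) (by positivity), ← Real.rpow_mul hA.le, ← Real.rpow_mul hM0.le, e2, e3]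

/-! ### Convolution operators and Fourier multipliers on tempered distributions. -/

lemma eLpNorm_one_mul_le_of_holderConjugate {X : Type*} [MeasurableSpace X] {μ : Measure X}
    {k g : X → ℂ} {r r' : ℝ≥0∞} (h : ENNReal.HolderConjugate r' r) (hk : AEStronglyMeasurable k μ)
    (hg : AEStronglyMeasurable g μ) :
    eLpNorm (fun x => k x * g x) 1 μ ≤ eLpNorm k r' μ * eLpNorm g r μ := by
  have e : (fun x => k x * g x) = k • g := rfl
  rw [e]
  exact eLpNorm_smul_le_mul_eLpNorm (p := r') (q := r) (r := 1) hg hk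

section Convolution

open FourierTransform

variable {V : Type*} [NormedAddCommGroup V] [InnerProductSpace ℝ V] [FiniteDimensional ℝ V]
  [MeasurableSpace V] [BorelSpace V]

/-- The convolution `K * g`. -/
noncomputable def kernelConv (K : 𝓢(V, ℂ)) (g : V → ℂ) (y : V) : ℂ := ∫ x, K (y - x) * g x

/-- A multiplier acts on distributions by transposition, and the left side is the transpose applied
to a test function. Moving the Fourier integral from `φ` onto the modulated `M` exhibits its kernel.
-/
lemma fourier_mul_fourierInv_apply (M φ : 𝓢(V, ℂ)) (x : V) :
    𝓕 (SchwartzMap.smulLeftCLM ℂ M (𝓕⁻ φ)) x = ∫ y, φ y * 𝓕⁻ M (y - x) := by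
  have hint : Integrable (fun ξ : V => 𝐞 (-inner ℝ ξ x) • M ξ) :=
    (VectorFourier.fourierIntegral_convergent_iff (μ := volume) (L := innerₗ V)
      Real.continuous_fourierChar continuous_inner x).2 M.integrable
  have h := VectorFourier.integral_fourierIntegral_smul_eq_flip (e := 𝐞) (μ := (volume : Measure V))
    (ν := (volume : Measure V)) (L := -innerₗ V) (f := φ) Real.continuous_fourierChar
    (continuous_inner (𝕜 := ℝ) (E := V)).neg φ.integrable hint
  rw [SchwartzMap.fourier_coe, Real.fourier_eq]
  have e1 : ∀ ξ : V, 𝐞 (-inner ℝ ξ x) • (SchwartzMap.smulLeftCLM ℂ M (𝓕⁻ φ)) ξ =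
      VectorFourier.fourierIntegral 𝐞 volume (-innerₗ V) φ ξ • (𝐞 (-inner ℝ ξ x) • M ξ) := by
    intro ξ
    have : VectorFourier.fourierIntegral 𝐞 volume (-innerₗ V) φ ξ = 𝓕⁻ φ ξ := by
      rw [SchwartzMap.fourierInv_coe]; rfl
    rw [this, SchwartzMap.smulLeftCLM_apply_apply M.hasTemperateGrowth]
    simp only [Circle.smul_def, smul_eq_mul]
    ring
  simp_rw [e1]
  rw [h]
  congr with v
  rw [smul_eq_mul]
  congr 1
  rw [SchwartzMap.fourierInv_coe, Real.fourierInv_eq]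
  unfold VectorFourier.fourierIntegral
  congr with ξ
  rw [smul_smul, ← AddChar.map_add_eq_mul]
  congr 2
  simp [inner_sub_right, real_inner_comm]
  ring

lemma memLp_sub_left (K : 𝓢(V, ℂ)) (r : ℝ≥0∞) (y : V) : MemLp (fun x => K (y - x)) r :=
  (K.memLp r).comp_measurePreserving (Measure.measurePreserving_sub_left volume y)

lemma eLpNorm_sub_left (K : 𝓢(V, ℂ)) (r : ℝ≥0∞) (y : V) :
    eLpNorm (fun x => K (y - x)) r volume = eLpNorm K r volume :=
  eLpNorm_comp_measurePreserving K.continuous.aestronglyMeasurable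
    (Measure.measurePreserving_sub_left volume y)

variable {g : V → ℂ} {r : ℝ≥0∞}

/-- Hölder, with uniformity in `y` because `x ↦ y - x` preserves measure. The bound serves
qualitatively, for integrability and Fubini; its size never enters the final constant. -/
lemma exists_eLpNorm_kernel_mul_le (K : 𝓢(V, ℂ)) (hr : 1 ≤ r) (hg : MemLp g r volume) :
    ∃ B : ℝ≥0∞, B ≠ ⊤ ∧ ∀ y, eLpNorm (fun x => K (y - x) * g x) 1 volume ≤ B := by
  obtain ⟨r', hconj⟩ : ∃ r', ENNReal.HolderConjugate r r' :=
    ⟨_, ENNReal.HolderConjugate.inv_one_sub_inv' hr⟩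
  obtain ⟨a, ha⟩ : ∃ a, a = eLpNorm K r' volume := ⟨_, rfl⟩
  obtain ⟨b, hb⟩ : ∃ b, b = eLpNorm g r volume := ⟨_, rfl⟩
  have ha' : a ≠ ⊤ := ha ▸ (K.memLp r' volume).2.ne
  have hb' : b ≠ ⊤ := hb ▸ hg.2.ne
  refine ⟨a * b, ENNReal.mul_ne_top ha' hb', fun y => ?_⟩
  have := eLpNorm_one_mul_le_of_holderConjugate hconj.symm (memLp_sub_left K r' y).1 hg.1
  rwa [eLpNorm_sub_left K r' y, ← ha, ← hb] at this

lemma integrable_kernel_mul (K : 𝓢(V, ℂ)) (hr : 1 ≤ r) (hg : MemLp g r volume) (y : V) :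
    Integrable (fun x => K (y - x) * g x) := by
  obtain ⟨B, hB, h⟩ := exists_eLpNorm_kernel_mul_le K hr hg
  rw [← memLp_one_iff_integrable]
  exact ⟨(memLp_sub_left K 1 y).1.mul hg.1, (h y).trans_lt hB.lt_top⟩

lemma aestronglyMeasurable_kernel_mul_prod (K : 𝓢(V, ℂ)) (hg : AEStronglyMeasurable g volume) :
    AEStronglyMeasurable (fun z : V × V => K (z.1 - z.2) * g z.2) (volume.prod volume) :=
  (K.continuous.comp (by fun_prop : Continuous fun z : V × V =>
    z.1 - z.2)).aestronglyMeasurable.mul hg.comp_snd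

lemma aestronglyMeasurable_kernelConv (K : 𝓢(V, ℂ)) (hg : AEStronglyMeasurable g volume) :
    AEStronglyMeasurable (kernelConv K g) volume :=
  (aestronglyMeasurable_kernel_mul_prod K hg).integral_prod_right'

lemma exists_integral_norm_kernel_mul_le (K : 𝓢(V, ℂ)) (hr : 1 ≤ r) (hg : MemLp g r volume) :
    ∃ B : ℝ, ∀ y, ∫ x, ‖K (y - x) * g x‖ ≤ B := by
  obtain ⟨B, hB, h⟩ := exists_eLpNorm_kernel_mul_le K hr hg
  refine ⟨B.toReal, fun y => ?_⟩
  rw [integral_norm_eq_lintegral_enorm (integrable_kernel_mul K hr hg y).1,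
    ← eLpNorm_one_eq_lintegral_enorm]
  exact ENNReal.toReal_mono hB (h y)

lemma memLp_top_kernelConv (K : 𝓢(V, ℂ)) (hr : 1 ≤ r) (hg : MemLp g r volume) :
    MemLp (kernelConv K g) ⊤ volume := by
  obtain ⟨B, hB⟩ := exists_integral_norm_kernel_mul_le K hr hg
  exact memLp_top_of_bound (aestronglyMeasurable_kernelConv K hg.1) B
    (.of_forall fun y => (norm_integral_le_integral_norm _).trans (hB y))

/-- Fubini's theorem for pairing a convolution with a Schwartz function. -/
lemma integral_mul_kernelConv (K φ : 𝓢(V, ℂ)) (hr : 1 ≤ r) (hg : MemLp g r volume) :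
    ∫ y, φ y * kernelConv K g y = ∫ x, (∫ y, φ y * K (y - x)) * g x := by
  obtain ⟨B, hB⟩ := exists_integral_norm_kernel_mul_le K hr hg
  have hm : AEStronglyMeasurable (fun z : V × V => φ z.1 * (K (z.1 - z.2) * g z.2))
      (volume.prod volume) :=
    φ.continuous.aestronglyMeasurable.comp_fst.mul (aestronglyMeasurable_kernel_mul_prod K hg.1)
  have hint : Integrable (fun z : V × V => φ z.1 * (K (z.1 - z.2) * g z.2))
      (volume.prod volume) := by
    rw [integrable_prod_iff hm]
    refine ⟨.of_forall fun y => (integrable_kernel_mul K hr hg y).const_mul (φ y), ?_⟩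
    refine (φ.integrable.norm.mul_const B).mono' hm.norm.integral_prod_right' (.of_forall fun y => ?_)
    rw [Real.norm_of_nonneg (integral_nonneg fun _ => norm_nonneg _)]
    simp_rw [norm_mul (φ y)]
    rw [integral_const_mul]
    exact mul_le_mul_of_nonneg_left (hB y) (norm_nonneg _)
  calc ∫ y, φ y * kernelConv K g y = ∫ y, ∫ x, φ y * (K (y - x) * g x) := by
        congr with y
        rw [integral_const_mul]; rfl
    _ = ∫ x, ∫ y, φ y * (K (y - x) * g x) := integral_integral_swap hint
    _ = _ := by
        congr with x
        rw [← integral_mul_const]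
        congr with y
        ring

/-- A Fourier multiplier with Schwartz symbol `M`, applied to the distribution given by an `L^r`
function, is given by convolution with `𝓕⁻ M`. -/
lemma fourierMultiplierCLM_eq_kernelConv (M : 𝓢(V, ℂ)) (hr : 1 ≤ r) (hg : MemLp g r volume)
    {u : 𝓢'(V, ℂ)} (hu : ∀ φ : 𝓢(V, ℂ), u φ = ∫ x, φ x * g x) (φ : 𝓢(V, ℂ)) :
    TemperedDistribution.fourierMultiplierCLM ℂ M u φ = ∫ x, φ x * kernelConv (𝓕⁻ M) g x := by
  rw [TemperedDistribution.fourierMultiplierCLM_apply_apply, hu, integral_mul_kernelConv _ _ hr hg]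
  simp_rw [fourier_mul_fourierInv_apply]

/-- The `L²` bound, by Plancherel's theorem. -/
lemma eLpNorm_two_kernelConv_le (M : 𝓢(V, ℂ)) (hM : ∀ ξ, ‖M ξ‖ ≤ 1) (hg : MemLp g 2 volume) :
    eLpNorm (kernelConv (𝓕⁻ M) g) 2 volume ≤ eLpNorm g 2 volume := by
  set f : Lp ℂ 2 (volume : Measure V) := hg.toLp g with hf
  have hMtop : MemLp M ⊤ (volume : Measure V) := M.memLp_top
  -- `G` is the multiplier applied on the `L²` side, where Plancherel gives the norm bound at once.
  -- It agrees with the convolution almost everywhere because both represent the same distribution.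
  set G : Lp ℂ 2 (volume : Measure V) := 𝓕⁻ (hMtop.toLp M • 𝓕 f : Lp ℂ 2 (volume : Measure V))
    with hG
  have hTu : TemperedDistribution.fourierMultiplierCLM ℂ M (f : 𝓢'(V, ℂ)) = (G : 𝓢'(V, ℂ)) := by
    rw [hG, ← Lp.fourierInv_toTemperedDistribution_eq,
      Lp.toTemperedDistribution_smul_eq M.hasTemperateGrowth,
      ← Lp.fourier_toTemperedDistribution_eq]
    rfl
  have hfu : ∀ φ : 𝓢(V, ℂ), (f : 𝓢'(V, ℂ)) φ = ∫ x, φ x * g x := by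
    intro φ
    rw [Lp.toTemperedDistribution_apply]
    refine integral_congr_ae ?_
    filter_upwards [hg.coeFn_toLp] with x hx
    rw [hf, hx, smul_eq_mul]
  have hae : kernelConv (𝓕⁻ M) g =ᵐ[volume] G := by
    refine ae_eq_of_integral_contDiff_smul_eq
      ((memLp_top_kernelConv _ one_le_two hg).locallyIntegrable le_top)
      ((Lp.memLp G).locallyIntegrable one_le_two) (fun h hh hc => ?_)
    have hc' : HasCompactSupport (Complex.ofRealCLM ∘ h) := hc.comp_left rfl
    have hh' : ContDiff ℝ ∞ (Complex.ofRealCLM ∘ h) := by fun_prop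
    have e1 := fourierMultiplierCLM_eq_kernelConv M one_le_two hg hfu (hc'.toSchwartzMap hh')
    rw [hTu, Lp.toTemperedDistribution_apply] at e1
    simpa using e1.symm
  rw [eLpNorm_congr_ae hae]
  have hnorm : ‖G‖ ≤ ‖f‖ := by
    have h1 : ‖G‖ = ‖(hMtop.toLp M • 𝓕 f : Lp ℂ 2 (volume : Measure V))‖ := by
      rw [hG]
      exact (Lp.fourierTransformₗᵢ V ℂ).symm.norm_map _
    have h2 : ‖hMtop.toLp M‖ ≤ 1 := by
      rw [Lp.norm_toLp, eLpNorm_exponent_top]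
      refine ENNReal.toReal_le_of_le_ofReal zero_le_one
        (eLpNormEssSup_le_of_ae_bound (.of_forall hM))
    rw [h1]
    refine (Lp.norm_smul_le _ _).trans ?_
    rw [Lp.norm_fourier_eq]
    exact mul_le_of_le_one_left (norm_nonneg _) h2
  rw [Lp.norm_def, Lp.norm_def, ENNReal.toReal_le_toReal (Lp.memLp G).2.ne (Lp.memLp f).2.ne] at hnorm
  exact hnorm.trans_eq (eLpNorm_congr_ae hg.coeFn_toLp)

lemma enorm_kernelConv_le (K : 𝓢(V, ℂ)) {A : ℝ} (hK : ∀ z, ‖K z‖ ≤ A) (g : V → ℂ) (y : V) :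
    ‖kernelConv K g y‖ₑ ≤ ENNReal.ofReal A * ∫⁻ x, ‖g x‖ₑ := by
  refine (enorm_integral_le_lintegral_enorm _).trans ?_
  rw [← lintegral_const_mul' _ _ ENNReal.ofReal_ne_top]
  refine lintegral_mono fun x => ?_
  rw [enorm_mul]
  gcongr
  rw [← ofReal_norm]
  exact ENNReal.ofReal_le_ofReal (hK _)

/-- Where `|f| ≤ l`, one has `|f|² ≤ l^(2-q) |f|^q`. -/
lemma memLp_two_indicator_norm_le {f : V → ℂ} {q l : ℝ} (hq0 : 0 < q) (hq : q ≤ 2) (hl : 0 < l)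
    (hfm : StronglyMeasurable f) (hf : MemLp f (ENNReal.ofReal q) volume) :
    MemLp ({x | ‖f x‖ ≤ l}.indicator f) 2 volume := by
  have hset : MeasurableSet {x | ‖f x‖ ≤ l} :=
    measurableSet_le hfm.norm.measurable measurable_const
  refine ⟨(hfm.indicator hset).aestronglyMeasurable, ?_⟩
  rw [eLpNorm_lt_top_iff_lintegral_rpow_enorm_lt_top (by norm_num) (by norm_num)]
  have hfin : ∫⁻ x, ‖f x‖ₑ ^ q < ⊤ := by
    have := (eLpNorm_lt_top_iff_lintegral_rpow_enorm_lt_top (by simpa using hq0)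
      ENNReal.ofReal_ne_top).1 hf.2
    rwa [ENNReal.toReal_ofReal hq0.le] at this
  refine lt_of_le_of_lt ?_ (ENNReal.mul_lt_top (a := ENNReal.ofReal (l ^ (2 - q)))
    ENNReal.ofReal_lt_top hfin)
  rw [← lintegral_const_mul' _ _ ENNReal.ofReal_ne_top]
  refine lintegral_mono fun x => ?_
  simp only [ENNReal.toReal_ofNat]
  by_cases hx : ‖f x‖ ≤ l
  · rw [Set.indicator_of_mem (by exact hx), enorm_rpow_eq_ofReal _ (by norm_num),
      enorm_rpow_eq_ofReal _ hq0.le, ← ENNReal.ofReal_mul (by positivity)]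
    refine ENNReal.ofReal_le_ofReal ?_
    rcases (norm_nonneg (f x)).eq_or_lt with h0 | h0
    · rw [← h0, Real.zero_rpow hq0.ne', Real.zero_rpow (by norm_num), mul_zero]
    · rw [show (2 : ℝ) = (2 - q) + q by ring, Real.rpow_add h0]
      simp only [sub_add_cancel]
      gcongr
  · rw [Set.indicator_of_notMem (by exact hx)]
    simp

/-- The `L^{p'} → L^p` bound for convolution operators with bounded kernel and bounded symbol. -/
theorem exists_eLpNorm_kernelConv_le (p p' : ℝ≥0∞) (hp : 2 ≤ p)
    (hpp' : ENNReal.HolderConjugate p p') :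
    ∃ c : ℝ, 0 < c ∧ ∀ (M : 𝓢(V, ℂ)) (A : ℝ) (g : V → ℂ), (∀ ξ, ‖M ξ‖ ≤ 1) → 0 < A →
      (∀ z, ‖𝓕⁻ M z‖ ≤ A) → MemLp g p' volume →
      eLpNorm (kernelConv (𝓕⁻ M) g) p volume ≤
        ENNReal.ofReal (c * A ^ (1 - 2 * p⁻¹.toReal)) * eLpNorm g p' volume := by
  have hsum : p⁻¹ + p'⁻¹ = 1 := ENNReal.HolderConjugate.inv_add_inv_eq_one p p'
  rcases eq_or_ne p ⊤ with rfl | hptop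
  · refine ⟨1, one_pos, fun M A g hM hA hK hg => ?_⟩
    have hp' : p' = 1 := by simpa using hsum
    subst hp'
    simp only [ENNReal.inv_top, ENNReal.toReal_zero, mul_zero, sub_zero, Real.rpow_one, one_mul]
    rw [eLpNorm_one_eq_lintegral_enorm, eLpNorm_exponent_top]
    exact eLpNormEssSup_le_of_ae_enorm_bound (.of_forall fun y => enorm_kernelConv_le _ hK g y)
  -- The endpoints are the two basic estimates themselves; the interpolation constant blows up as `p
  -- → 2`.
  rcases hp.eq_or_lt with rfl | hp2
  · refine ⟨1, one_pos, fun M A g hM hA hK hg => ?_⟩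
    have hp' : p' = 2 := by
      have h1 : (2 : ℝ≥0∞)⁻¹ + p'⁻¹ = 2⁻¹ + 2⁻¹ := by rw [hsum, ENNReal.inv_two_add_inv_two]
      exact inv_injective ((ENNReal.add_right_inj (by simp)).1 h1)
    subst hp'
    have : (2 : ℝ≥0∞)⁻¹.toReal = 1 / 2 := by simp
    rw [this]
    norm_num
    exact eLpNorm_two_kernelConv_le M hM hg
  set P := p.toReal with hP
  have hpP : p = ENNReal.ofReal P := (ENNReal.ofReal_toReal hptop).symm
  have hP2 : 2 < P := by
    rw [hpP, show (2 : ℝ≥0∞) = ENNReal.ofReal 2 by simp] at hp2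
    exact (ENNReal.ofReal_lt_ofReal_iff_of_nonneg (by norm_num)).1 hp2
  have hP0 : 0 < P := by linarith
  have hP1 : 0 < P - 1 := by linarith
  have hP2' : 0 < P - 2 := by linarith
  have hpinv : p⁻¹ = ENNReal.ofReal P⁻¹ := by rw [hpP, ENNReal.ofReal_inv_of_pos hP0]
  have hp'Q : p' = ENNReal.ofReal (P / (P - 1)) := by
    have h1 : p⁻¹ + p'⁻¹ = p⁻¹ + (ENNReal.ofReal (P / (P - 1)))⁻¹ := by
      rw [hsum, hpinv, ← ENNReal.ofReal_inv_of_pos (by positivity),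
        ← ENNReal.ofReal_add (by positivity) (by positivity), ← ENNReal.ofReal_one]
      congr 1
      field_simp
      ring
    exact inv_injective ((ENNReal.add_right_inj (by rw [hpinv]; exact ENNReal.ofReal_ne_top)).1 h1)
  refine ⟨(4 * P / (P - 2) * 2 ^ (P - 2)) ^ (1 / P), by positivity, fun M A g hM hA hK hg => ?_⟩
  have hexp : 1 - 2 * p⁻¹.toReal = 1 - 2 / P := by
    rw [hpinv, ENNReal.toReal_ofReal (by positivity)]
    ring
  rw [hexp]
  -- replace `g` by a strongly measurable representative
  set f := hg.1.mk g with hf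
  have hgf : g =ᵐ[volume] f := hg.1.ae_eq_mk
  have hfm : StronglyMeasurable f := hg.1.stronglyMeasurable_mk
  have hfp : MemLp f p' volume := (memLp_congr_ae hgf).1 hg
  have hconv : kernelConv (𝓕⁻ M) g = kernelConv (𝓕⁻ M) f := by
    funext y
    refine integral_congr_ae ?_
    filter_upwards [hgf] with x hx
    rw [hx]
  have hp'1 : 1 ≤ p' := by
    rw [hp'Q, ← ENNReal.ofReal_one]
    refine ENNReal.ofReal_le_ofReal ?_
    rw [le_div_iff₀ hP1]
    linarith
  have hq2 : P / (P - 1) ≤ 2 := by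
    rw [div_le_iff₀ hP1]
    linarith
  rw [hconv, eLpNorm_congr_ae hgf, hp'Q]
  nth_rewrite 1 [hpP]
  refine eLpNorm_le_of_truncation hP2 hA hfm (hp'Q ▸ hfp)
    (aestronglyMeasurable_kernelConv _ hfp.1) (fun l hl => ?_)
  have hset : MeasurableSet {x | ‖f x‖ ≤ l} :=
    measurableSet_le hfm.norm.measurable measurable_const
  have hset' : MeasurableSet {x | l < ‖f x‖} :=
    measurableSet_lt measurable_const hfm.norm.measurable
  have h2 : MemLp ({x | ‖f x‖ ≤ l}.indicator f) 2 volume :=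
    memLp_two_indicator_norm_le (by positivity) hq2 hl hfm (hp'Q ▸ hfp)
  refine ⟨kernelConv (𝓕⁻ M) ({x | l < ‖f x‖}.indicator f),
    kernelConv (𝓕⁻ M) ({x | ‖f x‖ ≤ l}.indicator f),
    aestronglyMeasurable_kernelConv _ h2.1, .of_forall fun y => ?_, .of_forall fun y => ?_, ?_⟩
  · have hi1 := integrable_kernel_mul (𝓕⁻ M) hp'1 (hfp.indicator hset') y
    have hi2 := integrable_kernel_mul (𝓕⁻ M) hp'1 (hfp.indicator hset) y
    rw [Pi.add_apply]
    unfold kernelConv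
    rw [← integral_add hi1 hi2]
    congr with x
    rw [← mul_add]
    congr 1
    by_cases hx : ‖f x‖ ≤ l
    · simp [Set.indicator, hx, not_lt.2 hx]
    · simp [Set.indicator, hx, not_le.1 hx]
  · refine (enorm_kernelConv_le _ hK _ y).trans (le_of_eq ?_)
    rw [← lintegral_indicator hset']
    simp_rw [enorm_indicator_eq_indicator_enorm]
  · have := eLpNorm_two_kernelConv_le M hM h2
    rw [eLpNorm_eq_lintegral_rpow_enorm_toReal (by norm_num) (by norm_num),
      eLpNorm_eq_lintegral_rpow_enorm_toReal (by norm_num) (by norm_num),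
      ENNReal.rpow_le_rpow_iff (by norm_num)] at this
    simp only [ENNReal.toReal_ofNat, ENNReal.rpow_ofNat] at this
    refine this.trans (le_of_eq ?_)
    rw [← lintegral_indicator hset]
    congr with x
    by_cases hx : x ∈ {x | ‖f x‖ ≤ l}
    · rw [Set.indicator_of_mem hx, Set.indicator_of_mem hx]
    · rw [Set.indicator_of_notMem hx, Set.indicator_of_notMem hx]
      simp

end Convolution

/-- The `L^{p'} → L^p` bound for a Fourier multiplier on tempered distributions. -/
theorem exists_distLpNorm_fourierMultiplierCLM_le {d : ℕ} (p p' : ℝ≥0∞) (hp : 2 ≤ p)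
    (hpp' : ENNReal.HolderConjugate p p') :
    ∃ c : ℝ, 0 < c ∧ ∀ (M : 𝓢(EuclideanSpace ℝ (Fin d), ℂ)) (A : ℝ)
      (u : 𝓢'(EuclideanSpace ℝ (Fin d), ℂ)), (∀ ξ, ‖M ξ‖ ≤ 1) → 0 < A →
      (∀ z, ‖FourierTransform.fourierInv M z‖ ≤ A) →
      distLpNorm p (TemperedDistribution.fourierMultiplierCLM ℂ M u) ≤
        ENNReal.ofReal (c * A ^ (1 - 2 * p⁻¹.toReal)) * distLpNorm p' u := by
  obtain ⟨c, hc, H⟩ := exists_eLpNorm_kernelConv_le (V := EuclideanSpace ℝ (Fin d)) p p' hp hpp'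
  refine ⟨c, hc, fun M A u hM hA hK => ?_⟩
  have hpos : 0 < c * A ^ (1 - 2 * p⁻¹.toReal) := by positivity
  have hp'1 : 1 ≤ p' := ENNReal.HolderConjugate.one_le p' p
  unfold distLpNorm
  -- A nonzero finite factor commutes with the infimum over representatives, so one representative
  -- `g` can be treated at a time.
  simp_rw [ENNReal.mul_iInf_of_ne (ENNReal.ofReal_pos.2 hpos).ne' ENNReal.ofReal_ne_top]
  refine le_iInf fun g => le_iInf fun hg => le_iInf fun hu => ?_
  have hb := H M A g hM hA hK hg
  refine iInf_le_of_le (kernelConv (FourierTransform.fourierInv M) g) (iInf_le_of_le ?_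
    (iInf_le_of_le ?_ hb))
  · exact ⟨aestronglyMeasurable_kernelConv _ hg.1,
      hb.trans_lt (ENNReal.mul_lt_top ENNReal.ofReal_lt_top hg.2)⟩
  · exact fun φ => fourierMultiplierCLM_eq_kernelConv M hp'1 hg hu φ

/-! ### The frequency-localised propagator and its kernel. -/

section Propagator

variable {d : ℕ} [NeZero d]

open Polynomial in
/-- The one-dimensional phase in the `i`-th coordinate direction. -/
noncomputable def coordPhase (α β γ : ℝ) (i : Fin d) : ℝ[X] :=
  if i = 0 then C γ * X ^ 4 + C β * X ^ 3 + C α * X ^ 2 else C α * X ^ 2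

lemma sum_eval_coordPhase (α β γ : ℝ) (ξ : EuclideanSpace ℝ (Fin d)) :
    ∑ i, (coordPhase α β γ i).eval (ξ i) = α * ‖ξ‖ ^ 2 + β * ξ 0 ^ 3 + γ * ξ 0 ^ 4 := by
  have h : ∀ i : Fin d, (coordPhase α β γ i).eval (ξ i) =
      α * (ξ i) ^ 2 + if i = 0 then β * ξ 0 ^ 3 + γ * ξ 0 ^ 4 else 0 := by
    intro i
    by_cases hi : i = 0
    · subst hi
      simp [coordPhase]
      ring
    · simp [coordPhase, hi]
  simp_rw [h, Finset.sum_add_distrib, ← Finset.mul_sum, EuclideanSpace.norm_sq_eq]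
  simp [add_assoc]

lemma natDegree_coordPhase_zero {α β γ : ℝ} (hβγ : (β, γ) ≠ (0, 0)) :
    (coordPhase (d := d) α β γ 0).natDegree = if γ ≠ 0 then 4 else 3 := by
  unfold coordPhase
  rw [if_pos rfl]
  split_ifs with hγ
  · compute_degree!
  · have hγ' : γ = 0 := not_not.1 hγ
    subst hγ'
    have hβ : β ≠ 0 := fun h => hβγ (by rw [h])
    rw [Polynomial.C_0, zero_mul, zero_add]
    compute_degree!

lemma natDegree_coordPhase {α β γ : ℝ} (hα : α ≠ 0) {i : Fin d} (hi : i ≠ 0) :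
    (coordPhase α β γ i).natDegree = 2 := by
  unfold coordPhase
  rw [if_neg hi]
  compute_degree!

/-- The propagator symbol localised near `κ` by a product cut-off. -/
noncomputable def localizedSymbol (χ : ℝ → ℝ) (α β γ t : ℝ) (κ η : EuclideanSpace ℝ (Fin d)) : ℂ :=
  propagatorSymbol α β γ t η * ∏ i, (χ (η i - κ i) : ℂ)

lemma contDiff_localizedSymbol {χ : ℝ → ℝ} (hχ : ContDiff ℝ ∞ χ) (α β γ t : ℝ)
    (κ : EuclideanSpace ℝ (Fin d)) : ContDiff ℝ ∞ (localizedSymbol χ α β γ t κ) := by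
  refine (hasTemperateGrowth_propagatorSymbol α β γ t).1.mul (contDiff_prod fun i _ => ?_)
  have h : ContDiff ℝ ∞ (fun η : EuclideanSpace ℝ (Fin d) => η i - κ i) :=
    (hasTemperateGrowth_coord i).1.sub contDiff_const
  exact Complex.ofRealCLM.contDiff.comp (hχ.comp h)

lemma hasCompactSupport_localizedSymbol {χ : ℝ → ℝ} (hc : HasCompactSupport χ) (α β γ t : ℝ)
    (κ : EuclideanSpace ℝ (Fin d)) : HasCompactSupport (localizedSymbol χ α β γ t κ) := by
  have hK : IsCompact ((EuclideanSpace.equiv (Fin d) ℝ).toHomeomorph ⁻¹'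
      (Set.univ.pi fun i => (fun x : ℝ => x - κ i) ⁻¹' tsupport χ)) := by
    rw [Homeomorph.isCompact_preimage]
    refine isCompact_univ_pi fun i => ?_
    exact (Homeomorph.subRight (κ i)).isCompact_preimage.2 hc
  refine HasCompactSupport.intro hK fun η hη => ?_
  have : ∃ i, η i - κ i ∉ tsupport χ := by
    by_contra! h
    exact hη fun i _ => h i
  obtain ⟨i, hi⟩ := this
  unfold localizedSymbol
  rw [Finset.prod_eq_zero (Finset.mem_univ i), mul_zero]
  rw [image_eq_zero_of_notMem_tsupport hi, Complex.ofReal_zero]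

lemma norm_propagatorSymbol (α β γ t : ℝ) (η : EuclideanSpace ℝ (Fin d)) :
    ‖propagatorSymbol α β γ t η‖ = 1 :=
  norm_cexp_I_mul_ofReal _

lemma norm_localizedSymbol_le {χ : ℝ → ℝ} (h0 : ∀ x, 0 ≤ χ x) (h1 : ∀ x, χ x ≤ 1) (α β γ t : ℝ)
    (κ η : EuclideanSpace ℝ (Fin d)) : ‖localizedSymbol χ α β γ t κ η‖ ≤ 1 := by
  unfold localizedSymbol
  rw [norm_mul, norm_propagatorSymbol, one_mul, norm_prod]
  refine Finset.prod_le_one (fun _ _ => norm_nonneg _) fun i _ => ?_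
  rw [Complex.norm_real, Real.norm_of_nonneg (h0 _)]
  exact h1 _

/-- The oscillatory integral with the localised symbol factorises over the coordinates. -/
lemma integral_localizedSymbol_eq_prod (χ : ℝ → ℝ) (α β γ t : ℝ)
    (κ z : EuclideanSpace ℝ (Fin d)) :
    ∫ η, Complex.exp (Complex.I * ((inner ℝ η z : ℝ) : ℂ)) * localizedSymbol χ α β γ t κ η =
      ∏ i, ∫ ξ : ℝ, Complex.exp (Complex.I *
        ((z i * ξ + t * (coordPhase α β γ i).eval ξ : ℝ) : ℂ)) * (χ (ξ - κ i) : ℂ) := by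
  rw [← integral_fintype_prod_volume_eq_prod (f := fun i (ξ : ℝ) => Complex.exp (Complex.I *
        ((z i * ξ + t * (coordPhase α β γ i).eval ξ : ℝ) : ℂ)) * (χ (ξ - κ i) : ℂ)),
    ← (PiLp.volume_preserving_toLp (Fin d)).integral_comp
      (MeasurableEquiv.toLp 2 _).measurableEmbedding]
  congr with x
  rw [Finset.prod_mul_distrib, ← Complex.exp_sum]
  unfold localizedSymbol propagatorSymbol
  rw [← mul_assoc, ← Complex.exp_add, ← sum_eval_coordPhase]
  congr 2
  rw [← mul_add, ← Finset.mul_sum, ← Complex.ofReal_add, ← Complex.ofReal_sum]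
  congr 2
  rw [PiLp.inner_apply, Finset.sum_add_distrib, Finset.sum_mul]
  congr 1
  exact Finset.sum_congr rfl fun i _ => mul_comm _ _

/-- The one-dimensional decay exponents add up over the coordinates: `1/2` from each quadratic
phase, `1/4` or `1/3` from coordinate `0`. -/
lemma exists_norm_integral_localizedSymbol_le {χ : ℝ → ℝ} (hχ : ContDiff ℝ ∞ χ)
    (hc : HasCompactSupport χ) {α β γ : ℝ} (hα : α ≠ 0) (hβγ : (β, γ) ≠ (0, 0)) :
    ∃ C : ℝ, 0 < C ∧ ∀ (t : ℝ) (κ z : EuclideanSpace ℝ (Fin d)),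
      ‖∫ η, Complex.exp (Complex.I * ((inner ℝ η z : ℝ) : ℂ)) * localizedSymbol χ α β γ t κ η‖ ≤
        C * (1 + |t|) ^ (-(((d : ℝ) - 1) / 2 + 1 / (if γ ≠ 0 then (4 : ℝ) else 3))) := by
  have hχ' : ContDiff ℝ 1 (fun x => (χ x : ℂ)) :=
    Complex.ofRealCLM.contDiff.comp (hχ.of_le (by exact_mod_cast le_top))
  have hc' : HasCompactSupport (fun x => (χ x : ℂ)) := hc.comp_left Complex.ofReal_zero
  have hdeg : ∀ i : Fin d, 2 ≤ (coordPhase α β γ i).natDegree := by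
    intro i
    by_cases hi : i = 0
    · subst hi
      rw [natDegree_coordPhase_zero hβγ]
      split_ifs <;> norm_num
    · rw [natDegree_coordPhase hα hi]
  choose C hC hbound using fun i : Fin d =>
    exists_norm_oscillatory_integral_le (coordPhase α β γ i) (hdeg i) hχ' hc'
  refine ⟨∏ i, C i, Finset.prod_pos fun i _ => hC i, fun t κ z => ?_⟩
  have ht : 0 < 1 + |t| := by positivity
  rw [integral_localizedSymbol_eq_prod, norm_prod]
  refine (Finset.prod_le_prod (fun _ _ => norm_nonneg _)
    (fun i _ => hbound i t (z i) (κ i))).trans (le_of_eq ?_)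
  rw [Finset.prod_mul_distrib, ← Real.rpow_sum_of_pos ht]
  congr 2
  rw [Finset.sum_neg_distrib]
  congr 1
  have hterm : ∀ i : Fin d, 1 / ((coordPhase α β γ i).natDegree : ℝ) =
      1 / 2 + if i = 0 then 1 / (if γ ≠ 0 then (4 : ℝ) else 3) - 1 / 2 else 0 := by
    intro i
    by_cases hi : i = 0
    · subst hi
      rw [natDegree_coordPhase_zero hβγ, if_pos rfl]
      split_ifs <;> norm_num
    · rw [natDegree_coordPhase hα hi, if_neg hi]
      norm_num
  simp_rw [hterm, Finset.sum_add_distrib]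
  simp
  ring

/-- The localised symbol in Mathlib's normalisation of the Fourier transform, as a Schwartz
function. -/
noncomputable def localizedSchwartz {χ : ℝ → ℝ} (hχ : ContDiff ℝ ∞ χ) (hc : HasCompactSupport χ)
    (α β γ t : ℝ) (κ : EuclideanSpace ℝ (Fin d)) : 𝓢(EuclideanSpace ℝ (Fin d), ℂ) :=
  HasCompactSupport.toSchwartzMap (f := fun ξ => localizedSymbol χ α β γ t κ ((2 * π) • ξ))
    ((hasCompactSupport_localizedSymbol hc α β γ t κ).comp_homeomorph
      (Homeomorph.smulOfNeZero (2 * π) (by positivity)))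
    ((contDiff_localizedSymbol hχ α β γ t κ).comp (contDiff_const_smul (2 * π)))

lemma norm_localizedSchwartz_le {χ : ℝ → ℝ} (hχ : ContDiff ℝ ∞ χ) (hc : HasCompactSupport χ)
    (h0 : ∀ x, 0 ≤ χ x) (h1 : ∀ x, χ x ≤ 1) (α β γ t : ℝ) (κ ξ : EuclideanSpace ℝ (Fin d)) :
    ‖localizedSchwartz hχ hc α β γ t κ ξ‖ ≤ 1 :=
  norm_localizedSymbol_le h0 h1 α β γ t κ ((2 * π) • ξ)

/-- Rescaling frequency by `2π` costs the Jacobian `(2π)^{-d} ≤ 1`. -/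
lemma norm_fourierInv_localizedSchwartz_le {χ : ℝ → ℝ} (hχ : ContDiff ℝ ∞ χ)
    (hc : HasCompactSupport χ) (α β γ t : ℝ) (κ z : EuclideanSpace ℝ (Fin d)) :
    ‖FourierTransform.fourierInv (localizedSchwartz hχ hc α β γ t κ) z‖ ≤
      ‖∫ η, Complex.exp (Complex.I * ((inner ℝ η z : ℝ) : ℂ)) *
        localizedSymbol χ α β γ t κ η‖ := by
  rw [SchwartzMap.fourierInv_coe, Real.fourierInv_eq']
  set F : EuclideanSpace ℝ (Fin d) → ℂ := fun η =>
    Complex.exp (Complex.I * ((inner ℝ η z : ℝ) : ℂ)) * localizedSymbol χ α β γ t κ η with hF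
  have : ∀ v : EuclideanSpace ℝ (Fin d),
      Complex.exp (((2 * π * inner ℝ v z : ℝ) : ℂ) * Complex.I) •
        localizedSchwartz hχ hc α β γ t κ v = F ((2 * π) • v) := by
    intro v
    simp only [hF, real_inner_smul_left, smul_eq_mul, mul_comm Complex.I]
    rfl
  rw [integral_congr_ae (.of_forall this), Measure.integral_comp_smul, norm_smul]
  refine mul_le_of_le_one_left (norm_nonneg _) ?_
  rw [norm_abs_eq_norm, norm_inv, norm_pow]
  refine inv_le_one_of_one_le₀ (one_le_pow₀ ?_)
  rw [Real.norm_of_nonneg (by positivity)]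
  linarith [Real.pi_gt_three]

end Propagator

/-! ### Reduction to frequency blocks and conclusion. -/

lemma IsModulationWindow.hasCompactSupport {d : ℕ} {σ₀ : EuclideanSpace ℝ (Fin d) → ℂ}
    (h : IsModulationWindow σ₀) : HasCompactSupport σ₀ :=
  HasCompactSupport.intro (isCompact_closedBall 0 (√(d : ℝ))) fun _ hx =>
    image_eq_zero_of_notMem_tsupport fun hx' =>
      hx (Metric.ball_subset_closedBall (h.tsupport_subset hx'))

/-- On the frequency support of `□_k`, the propagator coincides with its localisation. -/
lemma boxOp_propagator {d : ℕ} [NeZero d] {σ₀ : EuclideanSpace ℝ (Fin d) → ℂ}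
    (hσ₀ : IsModulationWindow σ₀) {χ : ℝ → ℝ} (hχ : ContDiff ℝ ∞ χ) (hc : HasCompactSupport χ)
    (hχ1 : ∀ x, |x| ≤ √(d : ℝ) → χ x = 1) (α β γ t : ℝ) (k : Fin d → ℤ)
    (f : 𝓢'(EuclideanSpace ℝ (Fin d), ℂ)) :
    boxOp σ₀ k (propagator α β γ t f) =
      TemperedDistribution.fourierMultiplierCLM ℂ
        (localizedSchwartz hχ hc α β γ t (latticePoint k)) (boxOp σ₀ k f) := by
  have hprop : Function.HasTemperateGrowth
      (fun ξ : EuclideanSpace ℝ (Fin d) => propagatorSymbol α β γ t ((2 * π) • ξ)) := by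
    have h2 : Function.HasTemperateGrowth (fun ξ : EuclideanSpace ℝ (Fin d) => (2 * π) • ξ) := by
      fun_prop
    exact (hasTemperateGrowth_propagatorSymbol α β γ t).comp h2
  have hσ : Function.HasTemperateGrowth
      (fun ξ : EuclideanSpace ℝ (Fin d) => σ₀ ((2 * π) • ξ - latticePoint k)) := by
    refine HasCompactSupport.hasTemperateGrowth ?_ ?_
    · exact hσ₀.hasCompactSupport.comp_homeomorph
        ((Homeomorph.smulOfNeZero (2 * π) (by positivity)).trans
          (Homeomorph.subRight (latticePoint k)))
    · exact hσ₀.smooth.comp ((contDiff_const_smul (2 * π)).sub contDiff_const)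
  unfold boxOp propagator angularMultiplier
  rw [TemperedDistribution.fourierMultiplierCLM_fourierMultiplierCLM_apply hprop hσ,
    TemperedDistribution.fourierMultiplierCLM_fourierMultiplierCLM_apply hσ
      (localizedSchwartz hχ hc α β γ t (latticePoint k)).hasTemperateGrowth]
  congr 2
  funext ξ
  change propagatorSymbol α β γ t ((2 * π) • ξ) * σ₀ ((2 * π) • ξ - latticePoint k) =
    σ₀ ((2 * π) • ξ - latticePoint k) *
      localizedSymbol χ α β γ t (latticePoint k) ((2 * π) • ξ)
  by_cases h : σ₀ ((2 * π) • ξ - latticePoint k) = 0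
  · rw [h, mul_zero, zero_mul]
  -- Each coordinate of a point of the ball of radius `√d` is at most `√d` in size, so every factor
  -- of the cut-off is `1` there.
  · have hmem := hσ₀.tsupport_subset (subset_tsupport σ₀ (Function.mem_support.2 h))
    rw [mem_ball_zero_iff] at hmem
    unfold localizedSymbol
    rw [Finset.prod_eq_one, mul_one, mul_comm]
    intro i _
    rw [hχ1, Complex.ofReal_one]
    exact (PiLp.norm_apply_le ((2 * π) • ξ - latticePoint k) i).trans hmem.le

theorem theorem1p4 {d : ℕ} [NeZero d] (α β γ : ℝ) (hα : α ≠ 0) (hβγ : (β, γ) ≠ (0, 0))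
    (σ₀ : EuclideanSpace ℝ (Fin d) → ℂ) (hσ₀ : IsModulationWindow σ₀)
    (s : ℝ) (p p' q : ℝ≥0∞) (hp : 2 ≤ p) (hpp' : ENNReal.HolderConjugate p p') (hq : 1 ≤ q) :
    ∃ C : ℝ, 0 < C ∧
      ∀ (t : ℝ) (f : 𝓢'(EuclideanSpace ℝ (Fin d), ℂ)),
        modulationNorm σ₀ s p q (propagator α β γ t f) ≤
          ENNReal.ofReal (C * (1 + |t|) ^ (-decayRate d γ p)) * modulationNorm σ₀ s p' q f := by
  have hd : 0 < √(d : ℝ) := Real.sqrt_pos.2 (by exact_mod_cast NeZero.pos d)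
  let χ : ContDiffBump (0 : ℝ) := ⟨√(d : ℝ), √(d : ℝ) + 1, hd, by linarith⟩
  have hχ : ContDiff ℝ ∞ χ := χ.contDiff
  have hc : HasCompactSupport χ := χ.hasCompactSupport
  have hχ1 : ∀ x, |x| ≤ √(d : ℝ) → χ x = 1 := fun x hx =>
    χ.one_of_mem_closedBall (by simpa using hx)
  obtain ⟨C, hC, hker⟩ := exists_norm_integral_localizedSymbol_le (d := d) hχ hc hα hβγ
  obtain ⟨c, hc0, hmult⟩ := exists_distLpNorm_fourierMultiplierCLM_le (d := d) p p' hp hpp'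
  set n : ℝ := if γ ≠ 0 then (4 : ℝ) else 3 with hn
  set θ : ℝ := 1 - 2 * p⁻¹.toReal with hθ
  refine ⟨c * C ^ θ, by positivity, fun t f => ?_⟩
  have ht : 0 < 1 + |t| := by positivity
  -- `(d - 1)/2 + 1/n` is half of `d - 1/2` for `n = 4` and half of `d - 1/3` for `n = 3`, while `θ
  -- = 2 (1/2 - 1/p)`.
  have hdecay : -(((d : ℝ) - 1) / 2 + 1 / n) * θ = -decayRate d γ p := by
    unfold decayRate
    rw [hn, hθ]
    split_ifs <;> ring
  have hconst : c * (C * (1 + |t|) ^ (-(((d : ℝ) - 1) / 2 + 1 / n))) ^ θ =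
      c * C ^ θ * (1 + |t|) ^ (-decayRate d γ p) := by
    rw [Real.mul_rpow hC.le (by positivity), ← Real.rpow_mul ht.le, hdecay, mul_assoc]
  have hk : ∀ k, distLpNorm p (boxOp σ₀ k (propagator α β γ t f)) ≤
      ENNReal.ofReal (c * C ^ θ * (1 + |t|) ^ (-decayRate d γ p)) *
        distLpNorm p' (boxOp σ₀ k f) := by
    intro k
    rw [boxOp_propagator hσ₀ hχ hc hχ1, ← hconst]
    exact hmult (localizedSchwartz hχ hc α β γ t (latticePoint k)) _ (boxOp σ₀ k f)
      (norm_localizedSchwartz_le hχ hc (fun x => χ.nonneg) (fun x => χ.le_one) α β γ t _)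
      (by positivity) fun z =>
        (norm_fourierInv_localizedSchwartz_le hχ hc α β γ t _ z).trans (hker t _ z)
  unfold modulationNorm
  refine eLpNorm_le_mul_eLpNorm_of_ae_le_mul'' q (measurable_of_countable _).aestronglyMeasurable
    (.of_forall fun k => ?_)
  simp only [enorm_eq_self]
  rw [mul_left_comm]
  exact mul_le_mul_right (hk k) _
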